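/- Let $\mathcal F$ be a signature (a set of function symbols, each with a fixed arity), let $\mathcal V$ be a countably infinite set of variables, and let $\mathcal T(\mathcal F,\mathcal V)$ be the set of terms. Let $\square\notin\mathcal F\cup\mathcal V$ be a fresh constant, the hole. A context is a term over $\mathcal F\cup\{\square\}$ and $\mathcal V$ (with any number of holes, possibly none); $\mathcal C(\mathcal F,\mathcal V)$ is the set of contexts. Let $\sqsubseteq$ be the smallest reflexive and transitive relation on contexts that is monotone (closed under application of function symbols) and satisfies $\square\sqsubseteq C$ for all contexts $C$; $C\sqcup D$ denotes the supremum of $C$ and $D$ with respect to $\sqsubseteq$, which is defined only if it exists. $C|_p$ is the subterm of $C$ at position $p$ and $C[D]_p$ is the result of replacing it by $D$. $\mathcal{P}os_{\mathcal F}(C)$ and $\mathcal{P}os_{\square}(C)$ are the sets of positions of $C$ at which a symbol of $\mathcal F$, respectively a hole, occurs. A term rewrite system (TRS) $\mathcal R$ is a set of rules $\ell\to r$ with $\ell,r\in\mathcal T(\mathcal F,\mathcal V)$, where $\ell$ is not a variable and every variable of $r$ occurs in $\ell$. For terms or contexts $s,t$ we write $s\to_{p,\ell\to r}t$ if there is a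 substitution $\sigma$ with $s|_p=\ell\sigma$ and $t=s[r\sigma]_p$ (the hole is treated as a constant), and $\to_{\mathcal R}$ is the induced rewrite relation on $\mathcal T(\mathcal F,\mathcal V)$. A relation $\to$ is confluent if $b\mathrel{{}^*{\leftarrow}}a\to^*c$ always implies $b\to^*d\mathrel{{}^*{\leftarrow}}c$ for some $d$; it is confluent on a set $S$ if $S$ is closed under $\to$ and ${\to}\cap(S\times S)$ is confluent. $\mathcal R$ is confluent if $\to_{\mathcal R}$ is. Let $\mathbb L\subseteq\mathcal C(\mathcal F,\mathcal V)$. A top of a context $C$ is an $L\in\mathbb L$ with $L\sqsubseteq C$; a max-top of $C$ is a top of $C$ that is maximal with respect to $\sqsubseteq$ among the tops of $C$. $\mathbb L$ is a layer system if - (L1) each term in $\mathcal T(\mathcal F,\mathcal V)$ has a top different from $\square$; - (L2) if $x\in\mathcal V$, $C\in\mathcal C(\mathcal F,\mathcal V)$ and $p$ is a position of $C$, then $C[x]_p\in\mathbb L$ if and only if $C[\square]_p\in\mathbb L$; - (L3) if $L,N\in\mathbb L$, $p\in\mathcal{P}os_{\mathcal F}(L)$ and $L|_p\sqcup N$ is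 defined, then $L[L|_p\sqcup N]_p\in\mathbb L$. A TRS $\mathcal R$ is layered according to a layer system $\mathbb L$ if - (W) for every rule $\ell\to r$ of $\mathcal R$ and all terms $s,t$: if $M$ is a max-top of $s$, $p\in\mathcal{P}os_{\mathcal F}(M)$ and $s\to_{p,\ell\to r}t$, then $M\to_{p,\ell\to r}L$ for some $L\in\mathbb L$; - (C1) in (W), either $L$ is a max-top of $t$ or $L=\square$; - (C2) if $L,N\in\mathbb L$ and $L\sqsubseteq N$, then $L[N|_p]_p\in\mathbb L$ for every $p\in\mathcal{P}os_{\square}(L)$. In a layer system every term $t$ has a unique max-top $M$, and $M\neq\square$. Write $t=M[t_1,\dots,t_n]$, where $t_1,\dots,t_n$ are the subterms of $t$ at the positions of the holes of $M$. The rank of $t$ is defined recursively by $\operatorname{rank}(t)=1+\max\{\operatorname{rank}(t_i)\mid 1\le i\le n\}$, where $\max\varnothing=0$. **Theorem.** Let $\mathcal R$ be a TRS that is layered according to a layer system $\mathbb L$. If $\mathcal R$ is confluent on the set of terms of rank one, then $\mathcal R$ is confluent. (No linearity or non-duplication condition on $\mathcal R$ is assumed.) -/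

import Mathlib

universe u v w w'

namespace LayerSystem

/- A signature is a first-order language `F`, of which only the function symbols are used:
`F.Functions n` is the set of function symbols of arity `n`. Terms over `F` with variables from `V`
are Mathlib's terms `F.Term V`. -/

/-- Contexts with an arbitrary number of holes: terms over `F` with variables from `V` and one
additional atom, the hole. The atom `some x` stands for the variable `x`, the atom `none` for the
hole. -/
abbrev Ctx (F : FirstOrder.Language.{u, v}) (V : Type w) : Type (max u w) := F.Term (Option V)

/-- The hole, that is, the empty context. -/
def hole {F : FirstOrder.Language.{u, v}} {V : Type w} : Ctx F V := FirstOrder.Language.Term.var none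

/-- A variable, seen as a context. -/
def ctxVar {F : FirstOrder.Language.{u, v}} {V : Type w} (x : V) : Ctx F V := FirstOrder.Language.Term.var (some x)

/-- A term, seen as a context without holes. -/
def toCtx {F : FirstOrder.Language.{u, v}} {V : Type w} (t : F.Term V) : Ctx F V := t.relabel some

section Positions

variable {F : FirstOrder.Language.{u, v}} {X : Type w'}

/-- The subterm of `t` at position `p`, or `none` if `p` is not a position of `t`. Arguments are
numbered from `0`. -/
def subtermAt : F.Term X → List ℕ → Option (F.Term X)
  | t, [] => some t
  | .var _, _ :: _ => none
  | .func (l := n) _ ts, i :: p => if h : i < n then subtermAt (ts ⟨i, h⟩) p else none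

/-- `replaceAt t p s` is `t[s]_p`, the result of replacing the subterm of `t` at position `p` by `s`
(used for positions `p` of `t` only). -/
def replaceAt : F.Term X → List ℕ → F.Term X → F.Term X
  | _, [], s => s
  | .var x, _ :: _, _ => .var x
  | .func f ts, i :: p, s =>
      .func f (fun j => if (j : ℕ) = i then replaceAt (ts j) p s else ts j)

/-- `p` is a position of `t`. -/
def IsPos (t : F.Term X) (p : List ℕ) : Prop := ∃ s, subtermAt t p = some s

/-- `p` is a position of `t` at which a function symbol of the signature occurs. -/
def IsFunPos (t : F.Term X) (p : List ℕ) : Prop :=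
  ∃ (n : ℕ) (f : F.Functions n) (ts : Fin n → F.Term X), subtermAt t p = some (.func f ts)

end Positions

section Rewriting

/-- A rewrite rule `lhs → rhs`: the left-hand side is not a variable, and every variable of the
right-hand side occurs in the left-hand side. -/
structure Rule (F : FirstOrder.Language.{u, v}) (V : Type w) where
  lhs : F.Term V
  rhs : F.Term V
  lhs_not_var : ∀ x : V, lhs ≠ .var x
  vars_subset : open Classical in rhs.varFinset ⊆ lhs.varFinset

/-- A term rewrite system over the signature `F` and the variables `V`: a set of rewrite rules. -/
abbrev TRS (F : FirstOrder.Language.{u, v}) (V : Type w) : Type (max u w) := Set (Rule F V)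

variable {F : FirstOrder.Language.{u, v}} {V : Type w} {X : Type w'}

/-- `s →_{p, ρ} t`: the rewrite step from `s` to `t` with the rule `ρ` at position `p`. It is used for
terms (`X = V`) and for contexts (`X = Option V`, where the hole is treated like a constant). -/
def StepAt (ρ : Rule F V) (p : List ℕ) (s t : F.Term X) : Prop :=
  ∃ σ : V → F.Term X,
    subtermAt s p = some (ρ.lhs.subst σ) ∧ t = replaceAt s p (ρ.rhs.subst σ)

/-- The rewrite relation on terms that is induced by `R`. -/
def Step (R : TRS F V) (s t : F.Term V) : Prop := ∃ ρ ∈ R, ∃ p, StepAt ρ p s t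

/-- A relation is confluent if any two elements that are reachable from a common element have a
common reduct. -/
def IsConfluent {α : Type w'} (r : α → α → Prop) : Prop :=
  ∀ a b c : α, Relation.ReflTransGen r a b → Relation.ReflTransGen r a c →
    ∃ d, Relation.ReflTransGen r b d ∧ Relation.ReflTransGen r c d

/-- A relation `r` is confluent on a set `S` if `S` is closed under `r` and the restriction
`r ∩ (S × S)` is confluent. -/
def IsConfluentOn {α : Type w'} (r : α → α → Prop) (S : Set α) : Prop :=
  (∀ a b, a ∈ S → r a b → b ∈ S) ∧ IsConfluent (fun a b => r a b ∧ a ∈ S ∧ b ∈ S)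

end Rewriting

section Layers

variable {F : FirstOrder.Language.{u, v}} {V : Type w}

/-- The order `⊑` on contexts: the smallest reflexive and transitive relation that is monotone and
has the hole below every context. -/
inductive Below : Ctx F V → Ctx F V → Prop
  | refl (C : Ctx F V) : Below C C
  | trans {C D E : Ctx F V} : Below C D → Below D E → Below C E
  | mono {n : ℕ} (f : F.Functions n) {Cs Ds : Fin n → Ctx F V} :
      (∀ i, Below (Cs i) (Ds i)) → Below (.func f Cs) (.func f Ds)
  | hole_below (C : Ctx F V) : Below hole C

/-- `E` is the supremum of `C` and `D` with respect to `⊑`, i.e. `C ⊔ D` is defined and equal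
to `E`. -/
def IsMerge (C D E : Ctx F V) : Prop :=
  Below C E ∧ Below D E ∧ ∀ E', Below C E' → Below D E' → Below E E'

/-- `T` is a top of `C` according to `𝕃`. -/
def IsTop (𝕃 : Set (Ctx F V)) (T C : Ctx F V) : Prop := T ∈ 𝕃 ∧ Below T C

/-- `M` is a max-top of `C`: a top that is maximal with respect to `⊑` among the tops of `C`. -/
def IsMaxTop (𝕃 : Set (Ctx F V)) (M C : Ctx F V) : Prop :=
  IsTop 𝕃 M C ∧ ∀ N, IsTop 𝕃 N C → Below M N → N = M

/-- Each term has a non-empty top. -/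
def CondL1 (𝕃 : Set (Ctx F V)) : Prop :=
  ∀ t : F.Term V, ∃ T, IsTop 𝕃 T (toCtx t) ∧ T ≠ hole

/-- `C[x]_p ∈ 𝕃` if and only if `C[□]_p ∈ 𝕃`. -/
def CondL2 (𝕃 : Set (Ctx F V)) : Prop :=
  ∀ (x : V) (C : Ctx F V) (p : List ℕ), IsPos C p →
    (replaceAt C p (ctxVar x) ∈ 𝕃 ↔ replaceAt C p hole ∈ 𝕃)

/-- If `L` and `N` are layers, a function symbol occurs at position `p` of `L`, and `L|_p ⊔ N` is
defined, then `L[L|_p ⊔ N]_p` is a layer. -/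
def CondL3 (𝕃 : Set (Ctx F V)) : Prop :=
  ∀ L ∈ 𝕃, ∀ N ∈ 𝕃, ∀ (p : List ℕ) (C E : Ctx F V), IsFunPos L p →
    subtermAt L p = some C → IsMerge C N E → replaceAt L p E ∈ 𝕃

/-- `𝕃` is a layer system. -/
structure IsLayerSystem (𝕃 : Set (Ctx F V)) : Prop where
  condL1 : CondL1 𝕃
  condL2 : CondL2 𝕃
  condL3 : CondL3 𝕃

/-- If `M` is a max-top of the term `s`, a function symbol occurs at position `p` of `M`, and
`s →_{p, ρ} t` for a rule `ρ` of `R`, then `M →_{p, ρ} L` for some layer `L`. -/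
def CondW (𝕃 : Set (Ctx F V)) (R : TRS F V) : Prop :=
  ∀ ρ ∈ R, ∀ (s t : F.Term V) (M : Ctx F V) (p : List ℕ),
    IsMaxTop 𝕃 M (toCtx s) → IsFunPos M p → StepAt ρ p s t →
      ∃ L ∈ 𝕃, StepAt ρ p M L

/-- In the situation of `CondW`, the layer `L` is a max-top of `t` or empty. (There is at most one
context `L` with `M →_{p, ρ} L`.) -/
def CondC1 (𝕃 : Set (Ctx F V)) (R : TRS F V) : Prop :=
  ∀ ρ ∈ R, ∀ (s t : F.Term V) (M : Ctx F V) (p : List ℕ),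
    IsMaxTop 𝕃 M (toCtx s) → IsFunPos M p → StepAt ρ p s t →
      ∀ L ∈ 𝕃, StepAt ρ p M L → IsMaxTop 𝕃 L (toCtx t) ∨ L = hole

/-- If `L ⊑ N` are layers and `p` is a hole position of `L` then `L[N|_p]_p` is a layer. -/
def CondC2 (𝕃 : Set (Ctx F V)) : Prop :=
  ∀ L ∈ 𝕃, ∀ N ∈ 𝕃, Below L N → ∀ (p : List ℕ) (C : Ctx F V),
    subtermAt L p = some hole → subtermAt N p = some C → replaceAt L p C ∈ 𝕃

/-- `R` is layered according to the layer system `𝕃`. -/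
structure IsLayered (𝕃 : Set (Ctx F V)) (R : TRS F V) : Prop where
  isLayerSystem : IsLayerSystem 𝕃
  condW : CondW 𝕃 R
  condC1 : CondC1 𝕃 R
  condC2 : CondC2 𝕃

/-- `HasRank 𝕃 t m` says that the term `t` has rank `m`. The aliens of `t = M[t₁, …, tₙ]`, where `M`
is the max-top of `t`, are the subterms of `t` at the hole positions of `M`; the rank of `t` is one
plus the maximum `m` of the ranks of its aliens, where the maximum of the empty set is `0`. Here
`k p` is the rank of the alien at the hole position `p`. -/
inductive HasRank (𝕃 : Set (Ctx F V)) : F.Term V → ℕ → Prop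
  | intro {t : F.Term V} {M : Ctx F V} {k : List ℕ → ℕ} {m : ℕ} :
      IsMaxTop 𝕃 M (toCtx t) →
      (∀ p a, subtermAt M p = some hole → subtermAt t p = some a → HasRank 𝕃 a (k p)) →
      (∀ p, subtermAt M p = some hole → k p ≤ m) →
      (m = 0 ∨ ∃ p, subtermAt M p = some hole ∧ k p = m) →
      HasRank 𝕃 t (1 + m)

end Layers

end LayerSystem

/-! The proof is an induction on the rank: if all terms of rank at most `m + 1` are confluent, so
are those of rank at most `m + 2`. Aliens are hidden behind labels that are the aliens themselves,
so equal aliens carry equal labels and non-linear rules still match.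

In a term `s` of rank at most `m + 2`, the aliens of rank at most `m` are made visible again. The
result is `base 𝕃 m s`; its labels have rank exactly `m + 1`. By (L2), turning these labels into
variables gives a term of rank at most `m + 1` (`rankLE_base_subst`), so reduction in the base is
confluent (`baseReduces_confluent`). The complementary relation `AlienReduces` reduces labels,
sending equal labels to equal terms, and thus preserves redexes of the base
(`alienReduces_baseStep`).

The difficulty is that reducing an alien may enlarge the max-top. By (C2) an unchanged alien stays
an alien, and by (L3) a changed alien that is absorbed leaves only aliens of smaller rank
(`expanded_aliens`). An absorbed alien of rank at most `m + 1` therefore becomes entirely visible in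
the base, where base steps can continue its reduction.

Since the labels are confluent by induction, one function reduces finitely many of them so that
joinable labels become equal (`exists_balancing`). Hence base reduction followed by label reduction
has the diamond property (`layerReduces_diamond`), and both ends of any rewrite step reach a common
term by it (`exists_layerReduces_of_step`). Confluence follows by Church–Rosser. -/

namespace LayerSystem

/-! ### Positions, substitutions and variables of terms. -/

section Terms

variable {F : FirstOrder.Language.{u, v}} {V : Type w} {X Y Z : Type*}

@[simp] theorem subtermAt_nil (t : F.Term X) : subtermAt t [] = some t := by cases t <;> rfl

@[simp] theorem subtermAt_var_cons (x : X) (i : ℕ) (p : List ℕ) :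
    subtermAt (.var x : F.Term X) (i :: p) = none := rfl

@[simp] theorem subtermAt_func_cons {n : ℕ} (f : F.Functions n) (ts : Fin n → F.Term X) (i : Fin n)
    (p : List ℕ) : subtermAt (.func f ts) ((i : ℕ) :: p) = subtermAt (ts i) p := by
  simp [subtermAt]

@[simp] theorem replaceAt_nil (t s : F.Term X) : replaceAt t [] s = s := by cases t <;> rfl

@[simp] theorem replaceAt_func_cons {n : ℕ} (f : F.Functions n) (ts : Fin n → F.Term X) (i : Fin n)
    (p : List ℕ) (s : F.Term X) :
    replaceAt (.func f ts) ((i : ℕ) :: p) s =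
      .func f (Function.update ts i (replaceAt (ts i) p s)) := by
  simp only [replaceAt]
  congr 1
  funext j
  by_cases h : j = i
  · subst h; simp
  · simp [h, Fin.val_inj]

theorem exists_func_of_subtermAt_cons {t s : F.Term X} {j : ℕ} {p : List ℕ}
    (h : subtermAt t (j :: p) = some s) :
    ∃ (n : ℕ) (f : F.Functions n) (ts : Fin n → F.Term X) (i : Fin n),
      t = .func f ts ∧ j = i ∧ subtermAt (ts i) p = some s := by
  cases t with
  | var x => simp at h
  | @func n f ts =>
    by_cases hj : j < n
    · exact ⟨n, f, ts, ⟨j, hj⟩, rfl, rfl, by simpa [subtermAt, hj] using h⟩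
    · simp [subtermAt, hj] at h

theorem subtermAt_append (t : F.Term X) (p q : List ℕ) :
    subtermAt t (p ++ q) = (subtermAt t p).bind fun s => subtermAt s q := by
  induction p generalizing t with
  | nil => simp
  | cons i p ih =>
    cases t with
    | var x => rfl
    | @func n f ts =>
      by_cases hi : i < n
      · simpa [subtermAt, hi] using ih (ts ⟨i, hi⟩)
      · simp [subtermAt, hi]

theorem subtermAt_subst {t s : F.Term X} {p : List ℕ} (h : subtermAt t p = some s)
    (θ : X → F.Term Y) : subtermAt (t.subst θ) p = some (s.subst θ) := by
  induction p generalizing t with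
  | nil => simp_all
  | cons j p ih =>
    obtain ⟨n, f, ts, i, rfl, rfl, hi⟩ := exists_func_of_subtermAt_cons h
    simpa [FirstOrder.Language.Term.subst] using ih hi

theorem replaceAt_subst {t s : F.Term X} {p : List ℕ} (h : subtermAt t p = some s)
    (s' : F.Term X) (θ : X → F.Term Y) :
    (replaceAt t p s').subst θ = replaceAt (t.subst θ) p (s'.subst θ) := by
  induction p generalizing t with
  | nil => simp
  | cons j p ih =>
    obtain ⟨n, f, ts, i, rfl, rfl, hi⟩ := exists_func_of_subtermAt_cons h
    simp only [replaceAt_func_cons, FirstOrder.Language.Term.subst]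
    congr 1
    funext k
    by_cases hk : k = i
    · subst hk; simp [ih hi]
    · simp [hk]

theorem replaceAt_append {t s : F.Term X} {p : List ℕ} (h : subtermAt t p = some s) (q : List ℕ)
    (u : F.Term X) : replaceAt t (p ++ q) u = replaceAt t p (replaceAt s q u) := by
  induction p generalizing t with
  | nil => simp_all
  | cons j p ih =>
    obtain ⟨n, f, ts, i, rfl, rfl, hi⟩ := exists_func_of_subtermAt_cons h
    simp [ih hi]

theorem IsFunPos.subst {t : F.Term X} {p : List ℕ} (h : IsFunPos t p) (θ : X → F.Term Y) :
    IsFunPos (t.subst θ) p := by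
  obtain ⟨n, f, ts, h⟩ := h
  exact ⟨n, f, _, subtermAt_subst h θ⟩

@[simp] theorem subst_var_eq (x : X) (θ : X → F.Term Y) :
    (FirstOrder.Language.Term.var x : F.Term X).subst θ = θ x := rfl

@[simp] theorem subst_func_eq {n : ℕ} (f : F.Functions n) (ts : Fin n → F.Term X)
    (θ : X → F.Term Y) :
    (FirstOrder.Language.Term.func f ts).subst θ = .func f fun i => (ts i).subst θ := rfl

theorem subst_subst (t : F.Term X) (θ : X → F.Term Y) (η : Y → F.Term Z) :
    (t.subst θ).subst η = t.subst fun x => (θ x).subst η := by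
  induction t with
  | var x => rfl
  | func f ts ih => simp [ih]

theorem subst_var (t : F.Term X) : t.subst FirstOrder.Language.Term.var = t := by
  induction t with
  | var x => rfl
  | func f ts ih => simp [ih]

/-- The set of variables that occur in a term. -/
def vars : F.Term X → Set X
  | .var x => {x}
  | .func _ ts => ⋃ i, vars (ts i)

@[simp] theorem mem_vars_var {x y : X} : y ∈ vars (.var x : F.Term X) ↔ y = x := Iff.rfl

@[simp] theorem mem_vars_func {n : ℕ} {f : F.Functions n} {ts : Fin n → F.Term X} {y : X} :
    y ∈ vars (.func f ts) ↔ ∃ i, y ∈ vars (ts i) := by simp [vars]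

theorem finite_vars (t : F.Term X) : (vars t).Finite := by
  induction t with
  | var x => exact Set.finite_singleton x
  | func f ts ih => exact Set.finite_iUnion ih

theorem mem_varFinset_iff [DecidableEq X] {t : F.Term X} {x : X} :
    x ∈ t.varFinset ↔ x ∈ vars t := by
  induction t with
  | var y => simp [FirstOrder.Language.Term.varFinset]
  | func f ts ih => simp [FirstOrder.Language.Term.varFinset, ih]

theorem Rule.vars_rhs_subset (ρ : Rule F V) : vars ρ.rhs ⊆ vars ρ.lhs := by
  classical
  intro x hx
  have h := ρ.vars_subset
  rw [← mem_varFinset_iff] at hx ⊢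
  convert h (by convert hx)

theorem mem_vars_subst {t : F.Term X} {θ : X → F.Term Y} {y : Y} :
    y ∈ vars (t.subst θ) ↔ ∃ x ∈ vars t, y ∈ vars (θ x) := by
  induction t with
  | var x => simp
  | func f ts ih => simp only [subst_func_eq, mem_vars_func, ih]; tauto

theorem subst_congr {t : F.Term X} {θ η : X → F.Term Y} (h : ∀ x ∈ vars t, θ x = η x) :
    t.subst θ = t.subst η := by
  induction t with
  | var x => exact h x rfl
  | func f ts ih =>
    simp only [subst_func_eq]
    congr 1
    funext i
    exact ih i fun x hx => h x (mem_vars_func.2 ⟨i, hx⟩)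

theorem eq_of_subst_eq {t : F.Term X} {θ η : X → F.Term Y} (h : t.subst θ = t.subst η) :
    ∀ x ∈ vars t, θ x = η x := by
  induction t with
  | var x => rintro y rfl; exact h
  | func f ts ih =>
    intro x hx
    obtain ⟨i, hi⟩ := mem_vars_func.1 hx
    simp only [subst_func_eq, FirstOrder.Language.Term.func.injEq, heq_eq_eq, true_and] at h
    exact ih i (congrFun h i) x hi

theorem vars_subterm_subset {t s : F.Term X} {p : List ℕ} (h : subtermAt t p = some s) :
    vars s ⊆ vars t := by
  induction p generalizing t with
  | nil => simp_all
  | cons j p ih =>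
    obtain ⟨n, f, ts, i, rfl, rfl, hi⟩ := exists_func_of_subtermAt_cons h
    exact fun x hx => mem_vars_func.2 ⟨i, ih hi hx⟩

theorem exists_pos_of_mem_vars {t : F.Term X} {x : X} (h : x ∈ vars t) :
    ∃ p, subtermAt t p = some (.var x) := by
  induction t with
  | var y => exact ⟨[], by rw [mem_vars_var.1 h]; simp⟩
  | func f ts ih =>
    obtain ⟨i, hi⟩ := mem_vars_func.1 h
    obtain ⟨p, hp⟩ := ih i hi
    exact ⟨i :: p, by simpa using hp⟩

theorem vars_replaceAt_subset {t s : F.Term X} {p : List ℕ} (h : subtermAt t p = some s)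
    (u : F.Term X) : vars (replaceAt t p u) ⊆ vars t ∪ vars u := by
  induction p generalizing t with
  | nil => simp
  | cons j p ih =>
    obtain ⟨n, f, ts, i, rfl, rfl, hi⟩ := exists_func_of_subtermAt_cons h
    intro x hx
    simp only [replaceAt_func_cons, mem_vars_func] at hx
    obtain ⟨k, hk⟩ := hx
    by_cases hki : k = i
    · subst hki
      simp only [Function.update_self] at hk
      rcases ih hi hk with hx | hx
      · exact Or.inl (mem_vars_func.2 ⟨_, hx⟩)
      · exact Or.inr hx
    · rw [Function.update_of_ne hki] at hk
      exact Or.inl (mem_vars_func.2 ⟨_, hk⟩)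

end Terms

/-! ### Rewriting over arbitrary variable types. -/

section Steps

variable {F : FirstOrder.Language.{u, v}} {V : Type w} {X Y Z : Type*} {R : TRS F V} {ρ : Rule F V}
  {p : List ℕ}

theorem StepAt.subst {s t : F.Term X} (h : StepAt ρ p s t) (θ : X → F.Term Y) :
    StepAt ρ p (s.subst θ) (t.subst θ) := by
  obtain ⟨σ, h1, rfl⟩ := h
  refine ⟨fun x => (σ x).subst θ, ?_, ?_⟩
  · rw [subtermAt_subst h1, subst_subst]
  · rw [replaceAt_subst h1, subst_subst]

/-- The match fixes the substitution on the variables of `ρ.lhs`, hence on those of `ρ.rhs`. -/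
theorem StepAt.unique {s t t' : F.Term X} (h : StepAt ρ p s t) (h' : StepAt ρ p s t') : t = t' := by
  obtain ⟨σ, h1, rfl⟩ := h
  obtain ⟨σ', h1', rfl⟩ := h'
  have h := eq_of_subst_eq (Option.some.inj (h1.symm.trans h1'))
  rw [subst_congr fun x hx => h x (ρ.vars_rhs_subset hx)]

theorem StepAt.vars_subset {s t : F.Term X} (h : StepAt ρ p s t) : vars t ⊆ vars s := by
  obtain ⟨σ, h1, rfl⟩ := h
  refine (vars_replaceAt_subset h1 _).trans (Set.union_subset subset_rfl ?_)
  refine subset_trans ?_ (vars_subterm_subset h1)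
  intro x hx
  obtain ⟨y, hy, hx⟩ := mem_vars_subst.1 hx
  exact mem_vars_subst.2 ⟨y, ρ.vars_rhs_subset hy, hx⟩

theorem StepAt.isFunPos {s t : F.Term X} (h : StepAt ρ p s t) : IsFunPos s p := by
  obtain ⟨σ, h1, rfl⟩ := h
  cases hl : ρ.lhs with
  | var x => exact absurd hl (ρ.lhs_not_var x)
  | func f ts => exact ⟨_, f, _, by rw [h1, hl]; rfl⟩

theorem not_isFunPos_var (x : X) : ¬ IsFunPos (.var x : F.Term X) p := by
  rintro ⟨n, f, ts, h⟩
  cases p <;> simp at h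

theorem StepAt.of_append {s t a : F.Term X} {q : List ℕ} (h : StepAt ρ (q ++ p) s t)
    (ha : subtermAt s q = some a) : ∃ a', StepAt ρ p a a' ∧ t = replaceAt s q a' := by
  obtain ⟨σ, h1, rfl⟩ := h
  rw [subtermAt_append, ha] at h1
  exact ⟨_, ⟨σ, h1, rfl⟩, replaceAt_append ha _ _⟩

theorem StepAt.append {s a a' : F.Term X} {q : List ℕ} (h : StepAt ρ p a a')
    (ha : subtermAt s q = some a) : StepAt ρ (q ++ p) s (replaceAt s q a') := by
  obtain ⟨σ, h1, rfl⟩ := h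
  exact ⟨σ, by rw [subtermAt_append, ha]; exact h1, (replaceAt_append ha _ _).symm⟩

/-- The rewrite relation induced by `R` on terms over an arbitrary set of variables. -/
def Rewrites (R : TRS F V) (s t : F.Term X) : Prop := ∃ ρ ∈ R, ∃ p, StepAt ρ p s t

/-- The reflexive and transitive closure of `Rewrites R`. -/
abbrev Reduces (R : TRS F V) : F.Term X → F.Term X → Prop := Relation.ReflTransGen (Rewrites R)

theorem Rewrites.subst {s t : F.Term X} (h : Rewrites R s t) (θ : X → F.Term Y) :
    Rewrites R (s.subst θ) (t.subst θ) := by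
  obtain ⟨ρ, hρ, p, h⟩ := h
  exact ⟨ρ, hρ, p, h.subst θ⟩

theorem Reduces.subst {s t : F.Term X} (h : Reduces R s t) (θ : X → F.Term Y) :
    Reduces R (s.subst θ) (t.subst θ) :=
  Relation.ReflTransGen.lift (fun s : F.Term X => s.subst θ) (fun _ _ h => h.subst θ) _ _ h

theorem Reduces.vars_subset {s t : F.Term X} (h : Reduces R s t) : vars t ⊆ vars s := by
  induction h with
  | refl => exact subset_rfl
  | tail _ h ih =>
    obtain ⟨ρ, _, p, h⟩ := h
    exact h.vars_subset.trans ih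

theorem not_rewrites_var {x : X} {t : F.Term X} : ¬ Rewrites R (.var x) t := by
  rintro ⟨ρ, _, p, h⟩
  exact not_isFunPos_var x h.isFunPos

theorem Reduces.func_update {n : ℕ} (f : F.Functions n) (ts : Fin n → F.Term X) (i : Fin n)
    {a b : F.Term X} (h : Reduces R a b) :
    Reduces R (.func f (Function.update ts i a)) (.func f (Function.update ts i b)) := by
  refine Relation.ReflTransGen.lift (p := Rewrites R)
    (fun a => FirstOrder.Language.Term.func f (Function.update ts i a)) ?_ _ _ h
  rintro a b ⟨ρ, hρ, p, h⟩
  refine ⟨ρ, hρ, i :: p, ?_⟩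
  have := h.append (s := .func f (Function.update ts i a)) (q := [(i : ℕ)]) (by simp)
  simpa using this

theorem Reduces.func {n : ℕ} (f : F.Functions n) {ts us : Fin n → F.Term X}
    (h : ∀ i, Reduces R (ts i) (us i)) : Reduces R (.func f ts) (.func f us) := by
  classical
  suffices H : ∀ S : Finset (Fin n),
      Reduces R (.func f ts) (.func f fun i => if i ∈ S then us i else ts i) by
    simpa using H Finset.univ
  intro S
  induction S using Finset.induction_on with
  | empty => simpa using Relation.ReflTransGen.refl
  | insert i S hi ih =>
    refine ih.trans ?_
    have := Reduces.func_update f (fun j => if j ∈ S then us j else ts j) i (h i)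
    convert this using 2
    · funext j
      by_cases hj : j = i
      · subst hj; simp [hi]
      · simp [hj]
    · funext j
      by_cases hj : j = i
      · subst hj; simp
      · simp [hj]

theorem Reduces.subst_left {t : F.Term X} {θ η : X → F.Term Y}
    (h : ∀ x ∈ vars t, Reduces R (θ x) (η x)) : Reduces R (t.subst θ) (t.subst η) := by
  induction t with
  | var x => exact h x rfl
  | func f ts ih => exact Reduces.func f fun i => ih i fun x hx => h x (mem_vars_func.2 ⟨i, hx⟩)

end Steps

/-! ### The order on contexts: suprema, sizes and contexts that fit a term. -/

section Order

variable {F : FirstOrder.Language.{u, v}} {V : Type w}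

theorem Below.inv {C D : Ctx F V} (h : Below C D) :
    C = hole ∨ (∃ x, C = ctxVar x ∧ D = ctxVar x) ∨
      ∃ (n : ℕ) (f : F.Functions n) (Cs Ds : Fin n → Ctx F V),
        C = .func f Cs ∧ D = .func f Ds ∧ ∀ i, Below (Cs i) (Ds i) := by
  induction h with
  | refl C =>
    cases C with
    | var x =>
      cases x with
      | none => exact Or.inl rfl
      | some x => exact Or.inr (Or.inl ⟨x, rfl, rfl⟩)
    | func f Cs => exact Or.inr (Or.inr ⟨_, f, Cs, Cs, rfl, rfl, fun i => .refl _⟩)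
  | hole_below C => exact Or.inl rfl
  | mono f h _ => exact Or.inr (Or.inr ⟨_, f, _, _, rfl, rfl, h⟩)
  | trans _ _ ih1 ih2 =>
    rcases ih1 with h | ⟨x, rfl, rfl⟩ | ⟨n, f, Cs, Ds, rfl, rfl, h⟩
    · exact Or.inl h
    · rcases ih2 with e | ⟨y, e, e'⟩ | ⟨n, f, Cs, Ds, e, _⟩
      · cases e
      · exact Or.inr (Or.inl ⟨x, rfl, e'.trans e.symm⟩)
      · cases e
    · rcases ih2 with h' | ⟨y, h', rfl⟩ | ⟨n', f', Cs', Ds', h', rfl, h''⟩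
      · cases h'
      · cases h'
      · cases h'
        exact Or.inr (Or.inr ⟨_, f, _, _, rfl, rfl, fun i => (h i).trans (h'' i)⟩)

theorem below_hole_iff {C : Ctx F V} : Below C hole ↔ C = hole := by
  refine ⟨fun h => ?_, fun h => h ▸ .refl _⟩
  rcases h.inv with e | ⟨x, rfl, e⟩ | ⟨n, f, Cs, Ds, rfl, e, _⟩
  · exact e
  · cases e
  · cases e

theorem ctxVar_below_iff {x : V} {D : Ctx F V} : Below (ctxVar x) D ↔ D = ctxVar x := by
  refine ⟨fun h => ?_, fun h => h ▸ .refl _⟩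
  rcases h.inv with e | ⟨y, e, rfl⟩ | ⟨n, f, Cs, Ds, e, _⟩
  · cases e
  · exact e.symm
  · cases e

theorem func_below_iff {n : ℕ} {f : F.Functions n} {Cs : Fin n → Ctx F V} {D : Ctx F V} :
    Below (.func f Cs) D ↔ ∃ Ds, D = .func f Ds ∧ ∀ i, Below (Cs i) (Ds i) := by
  refine ⟨fun h => ?_, ?_⟩
  · rcases h.inv with e | ⟨y, e, _⟩ | ⟨n, f, Cs, Ds, e, rfl, h'⟩
    · cases e
    · cases e
    · cases e
      exact ⟨_, rfl, h'⟩
  · rintro ⟨Ds, rfl, h⟩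
    exact .mono f h

theorem below_func_iff {n : ℕ} {f : F.Functions n} {Ds : Fin n → Ctx F V} {C : Ctx F V} :
    Below C (.func f Ds) ↔ C = hole ∨ ∃ Cs, C = .func f Cs ∧ ∀ i, Below (Cs i) (Ds i) := by
  refine ⟨fun h => ?_, ?_⟩
  · rcases h.inv with h | ⟨y, _, h⟩ | ⟨n, f, Cs, Ds, rfl, h, h'⟩
    · exact Or.inl h
    · cases h
    · cases h
      exact Or.inr ⟨Cs, rfl, h'⟩
  · rintro (rfl | ⟨Ds, rfl, h⟩)
    · exact .hole_below _
    · exact .mono f h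

/-- The number of positions of a context that are not holes. -/
def ctxSize : Ctx F V → ℕ
  | .var none => 0
  | .var (some _) => 1
  | .func _ Cs => 1 + ∑ i, ctxSize (Cs i)

theorem Below.size_le {C D : Ctx F V} (h : Below C D) : ctxSize C ≤ ctxSize D := by
  induction h with
  | refl => exact le_rfl
  | trans _ _ ih1 ih2 => exact ih1.trans ih2
  | hole_below => exact Nat.zero_le _
  | mono f _ ih => exact Nat.add_le_add_left (Finset.sum_le_sum fun i _ => ih i) 1

theorem Below.eq_of_size_le {C D : Ctx F V} (h : Below C D) (hs : ctxSize D ≤ ctxSize C) :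
    C = D := by
  induction C generalizing D with
  | var x =>
    cases x with
    | some x => exact (ctxVar_below_iff.1 h).symm
    | none =>
      cases D with
      | var y =>
        cases y with
        | none => rfl
        | some y => simp [ctxSize] at hs
      | func f Ds => simp [ctxSize] at hs
  | func f Cs ih =>
    obtain ⟨Ds, rfl, hs'⟩ := func_below_iff.1 h
    congr 1
    funext i
    refine ih i (hs' i) (le_of_eq ?_)
    simp only [ctxSize, add_le_add_iff_left] at hs
    have := (Finset.sum_eq_sum_iff_of_le fun i _ => (hs' i).size_le).1
      (le_antisymm (Finset.sum_le_sum fun i _ => (hs' i).size_le) hs)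
    exact (this i (Finset.mem_univ i)).symm

theorem Below.antisymm {C D : Ctx F V} (h : Below C D) (h' : Below D C) : C = D :=
  h.eq_of_size_le h'.size_le

/-- Contexts with a common upper bound agree wherever neither has a hole, so they can be overlaid.
This makes (L3) applicable to two tops of the same term. -/
theorem exists_isMerge {C D Z : Ctx F V} (hC : Below C Z) (hD : Below D Z) :
    ∃ E, IsMerge C D E ∧ Below E Z := by
  induction C generalizing D Z with
  | var x =>
    cases x with
    | none => exact ⟨D, ⟨.hole_below _, .refl _, fun _ _ h => h⟩, hD⟩
    | some x =>
      obtain rfl := ctxVar_below_iff.1 hC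
      exact ⟨_, ⟨.refl _, hD, fun _ h _ => h⟩, .refl _⟩
  | @func n f Cs ih =>
    obtain ⟨Zs, rfl, hC'⟩ := func_below_iff.1 hC
    rcases below_func_iff.1 hD with rfl | ⟨Ds, rfl, hD'⟩
    · exact ⟨_, ⟨.refl _, .hole_below _, fun _ h _ => h⟩, .mono f hC'⟩
    · choose Es hE hEZ using fun i => ih i (hC' i) (hD' i)
      refine ⟨.func f Es, ⟨.mono f fun i => (hE i).1, .mono f fun i => (hE i).2.1, ?_⟩, .mono f hEZ⟩
      intro E' h1 h2
      obtain ⟨Es', rfl, h1'⟩ := func_below_iff.1 h1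
      rcases below_func_iff.1 h2 with h | ⟨Ds', h, h2⟩
      · cases h
      · cases h
        exact .mono f fun i => (hE i).2.2 _ (h1' i) (h2 i)

theorem Below.exists_subtermAt {C D c : Ctx F V} {q : List ℕ} (h : Below C D)
    (hc : subtermAt C q = some c) : ∃ d, subtermAt D q = some d ∧ Below c d := by
  induction q generalizing C D with
  | nil => simp at hc; subst hc; exact ⟨D, by simp, h⟩
  | cons j q ih =>
    obtain ⟨n, f, Cs, i, rfl, rfl, hi⟩ := exists_func_of_subtermAt_cons hc
    obtain ⟨Ds, rfl, hs'⟩ := func_below_iff.1 h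
    simpa using ih (hs' i) hi

theorem Below.replaceAt {C D c d K : Ctx F V} {q : List ℕ} (h : Below C D)
    (hc : subtermAt C q = some c) (hd : subtermAt D q = some d) (hK : Below K d) :
    Below (replaceAt C q K) D := by
  induction q generalizing C D with
  | nil => simp_all
  | cons j q ih =>
    obtain ⟨n, f, Cs, i, rfl, rfl, hi⟩ := exists_func_of_subtermAt_cons hc
    obtain ⟨Ds, rfl, hs'⟩ := func_below_iff.1 h
    rw [replaceAt_func_cons]
    refine .mono f fun k => ?_
    by_cases hk : k = i
    · subst hk; simpa using ih (hs' k) hi (by simpa using hd)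
    · simpa [hk] using hs' k

theorem Below.of_replaceAt {C D c d K : Ctx F V} {q : List ℕ}
    (h : Below (LayerSystem.replaceAt C q K) D)
    (hc : subtermAt C q = some c) (hd : subtermAt D q = some d) : Below K d := by
  induction q generalizing C D with
  | nil => simp_all
  | cons j q ih =>
    obtain ⟨n, f, Cs, i, rfl, rfl, hi⟩ := exists_func_of_subtermAt_cons hc
    rw [replaceAt_func_cons] at h
    obtain ⟨Ds, rfl, hs'⟩ := func_below_iff.1 h
    exact ih (by simpa using hs' i) hi (by simpa using hd)

/-- `M` is obtained from the term `s` by replacing some subterms by holes. -/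
def Fits (M : Ctx F V) (s : F.Term V) : Prop := Below M (toCtx s)

theorem toCtx_eq_subst (s : F.Term V) : toCtx s = s.subst ctxVar := by
  induction s with
  | var x => rfl
  | func f ts ih =>
    simp only [subst_func_eq, ← ih]
    rfl

@[simp] theorem toCtx_var (x : V) : toCtx (.var x : F.Term V) = ctxVar x := rfl

@[simp] theorem toCtx_func {n : ℕ} (f : F.Functions n) (ts : Fin n → F.Term V) :
    toCtx (.func f ts) = .func f fun i => toCtx (ts i) := rfl

theorem toCtx_injective {s t : F.Term V} (h : toCtx s = toCtx t) : s = t := by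
  induction s generalizing t with
  | var x =>
    cases t with
    | var y => cases h; rfl
    | func g us => cases h
  | func f ts ih =>
    cases t with
    | var y => cases h
    | func g us =>
      simp only [toCtx_func, FirstOrder.Language.Term.func.injEq] at h
      obtain ⟨rfl, h, h'⟩ := h
      cases h
      congr 1
      funext i
      exact ih i (congrFun (eq_of_heq h') i)

theorem subtermAt_toCtx {s a : F.Term V} {p : List ℕ} (h : subtermAt s p = some a) :
    subtermAt (toCtx s) p = some (toCtx a) := by
  rw [toCtx_eq_subst, toCtx_eq_subst]
  exact subtermAt_subst h _

theorem ctxVar_fits_iff {x : V} {s : F.Term V} : Fits (ctxVar x) s ↔ s = .var x := by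
  refine ⟨fun h => toCtx_injective (ctxVar_below_iff.1 h), fun h => h ▸ .refl _⟩

theorem func_fits_iff {n : ℕ} {f : F.Functions n} {Cs : Fin n → Ctx F V} {s : F.Term V} :
    Fits (.func f Cs) s ↔ ∃ ts, s = .func f ts ∧ ∀ i, Fits (Cs i) (ts i) := by
  refine ⟨fun h => ?_, ?_⟩
  · obtain ⟨Ds, h, h'⟩ := func_below_iff.1 h
    cases s with
    | var x => cases h
    | func g ts =>
      cases h
      exact ⟨ts, rfl, h'⟩
  · rintro ⟨ts, rfl, h⟩
    exact .mono f h

theorem Fits.exists_subtermAt {M C : Ctx F V} {s : F.Term V} {q : List ℕ} (h : Fits M s)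
    (hC : subtermAt M q = some C) : ∃ a, subtermAt s q = some a ∧ Fits C a := by
  induction q generalizing M s with
  | nil => simp at hC; subst hC; exact ⟨s, by simp, h⟩
  | cons j q ih =>
    obtain ⟨n, f, Cs, i, rfl, rfl, hi⟩ := exists_func_of_subtermAt_cons hC
    obtain ⟨ts, rfl, hs⟩ := func_fits_iff.1 h
    simpa using ih (hs i) hi

theorem Fits.replaceAt {M C K : Ctx F V} {s a : F.Term V} {q : List ℕ} (h : Fits M s)
    (hC : subtermAt M q = some C) (ha : subtermAt s q = some a) (hK : Fits K a) :
    Fits (replaceAt M q K) s :=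
  Below.replaceAt h hC (subtermAt_toCtx ha) hK

end Order

/-! ### Labelled terms as pairs of a context and a term that it fits. -/

section Labels

variable {F : FirstOrder.Language.{u, v}} {V : Type w}

/-- Terms in which some subterms have been hidden: the variable `.inr a` stands for the term
`a`. -/
abbrev LTerm (F : FirstOrder.Language.{u, v}) (V : Type w) : Type (max u w) :=
  F.Term (V ⊕ F.Term V)

/-- The term that is represented by a labelled term. -/
def val (E : LTerm F V) : F.Term V := E.subst (Sum.elim .var id)

/-- The context that arises from a labelled term by replacing all labels by holes. -/
def shape (E : LTerm F V) : Ctx F V := E.subst (Sum.elim ctxVar fun _ => hole)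

/-- A term as a labelled term without labels. -/
def unlabelled (t : F.Term V) : LTerm F V := t.subst fun x => .var (Sum.inl x)

/-- The `i`-th argument of a term. -/
def argument : F.Term V → ℕ → F.Term V
  | .var x, _ => .var x
  | .func (l := n) f ts, i => if h : i < n then ts ⟨i, h⟩ else .func f ts

@[simp] theorem argument_func {n : ℕ} (f : F.Functions n) (ts : Fin n → F.Term V) (i : Fin n) :
    argument (.func f ts) i = ts i := by simp [argument]

/-- The labelled term that arises from the context `M` by writing into each hole the subterm of `s`
at the same position. -/
def labelHoles : Ctx F V → F.Term V → LTerm F V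
  | .var none, s => .var (Sum.inr s)
  | .var (some x), _ => .var (Sum.inl x)
  | .func f Cs, s => .func f fun i => labelHoles (Cs i) (argument s i)

@[simp] theorem labelHoles_hole (s : F.Term V) : labelHoles hole s = .var (Sum.inr s) := rfl

@[simp] theorem labelHoles_ctxVar (x : V) (s : F.Term V) :
    labelHoles (ctxVar x) s = .var (Sum.inl x) := rfl

@[simp] theorem labelHoles_func {n : ℕ} (f : F.Functions n) (Cs : Fin n → Ctx F V)
    (ts : Fin n → F.Term V) :
    labelHoles (.func f Cs) (.func f ts) = .func f fun i => labelHoles (Cs i) (ts i) := by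
  simp [labelHoles]

theorem Fits.val_labelHoles {M : Ctx F V} {s : F.Term V} (h : Fits M s) :
    val (labelHoles M s) = s := by
  induction M generalizing s with
  | var x =>
    cases x with
    | none => rfl
    | some x => exact (ctxVar_fits_iff.1 h).symm
  | func f Cs ih =>
    obtain ⟨ts, rfl, hs⟩ := func_fits_iff.1 h
    rw [labelHoles_func]
    simp only [val, subst_func_eq] at ih ⊢
    congr 1
    funext i
    exact ih i (hs i)

theorem shape_labelHoles (M : Ctx F V) (s : F.Term V) : shape (labelHoles M s) = M := by
  induction M generalizing s with
  | var x => cases x <;> rfl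
  | func f Cs ih =>
    simp only [labelHoles, shape, subst_func_eq] at ih ⊢
    congr 1
    funext i
    exact ih i _

/-- A pattern that matches both the context and the term matches the labelled term, by a single
substitution even when variables repeat. -/
theorem labelHoles_subst {Y : Type*} (E : F.Term Y) (σ : Y → Ctx F V) (τ : Y → F.Term V) :
    labelHoles (E.subst σ) (E.subst τ) = E.subst fun y => labelHoles (σ y) (τ y) := by
  induction E with
  | var y => rfl
  | func f ts ih => simp [ih]

theorem labelHoles_shape_val (E : LTerm F V) : labelHoles (shape E) (val E) = E := by
  rw [shape, val, labelHoles_subst]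
  conv_rhs => rw [← subst_var E]
  congr 1
  funext y
  cases y <;> rfl

theorem shape_fits_val (E : LTerm F V) : Fits (shape E) (val E) := by
  induction E with
  | var y =>
    cases y with
    | inl x => exact .refl _
    | inr a => exact .hole_below _
  | func f ts ih => exact func_fits_iff.2 ⟨_, rfl, ih⟩

theorem subtermAt_labelHoles {M C : Ctx F V} {s a : F.Term V} {p : List ℕ}
    (hM : subtermAt M p = some C) (hs : subtermAt s p = some a) :
    subtermAt (labelHoles M s) p = some (labelHoles C a) := by
  induction p generalizing M s with
  | nil => simp_all
  | cons j p ih =>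
    obtain ⟨n, f, Cs, i, rfl, rfl, hi⟩ := exists_func_of_subtermAt_cons hM
    obtain ⟨m, g, ts, k, rfl, hk, hi'⟩ := exists_func_of_subtermAt_cons hs
    simp only [labelHoles, subtermAt_func_cons]
    rw [hk, argument_func]
    exact ih hi hi'

theorem replaceAt_labelHoles {M C K : Ctx F V} {s a b : F.Term V} {p : List ℕ}
    (h : Fits M s) (hM : subtermAt M p = some C) (hs : subtermAt s p = some a) :
    labelHoles (replaceAt M p K) (replaceAt s p b) =
      replaceAt (labelHoles M s) p (labelHoles K b) := by
  induction p generalizing M s with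
  | nil => simp
  | cons j p ih =>
    obtain ⟨n, f, Cs, i, rfl, rfl, hi⟩ := exists_func_of_subtermAt_cons hM
    obtain ⟨ts, rfl, h'⟩ := func_fits_iff.1 h
    simp only [replaceAt_func_cons, labelHoles_func]
    congr 1
    funext l
    by_cases hl : l = i
    · subst hl
      simpa using ih (h' l) hi (by simpa using hs)
    · simp [hl]

theorem val_unlabelled (t : F.Term V) : val (unlabelled t) = t := by
  rw [val, unlabelled, subst_subst]
  exact subst_var t

end Labels

/-! ### Max-tops and the rank of aliens. -/

section LayerSystems

variable {F : FirstOrder.Language.{u, v}} {V : Type w} {𝕃 : Set (Ctx F V)}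

/-- The context that arises by replacing all variables by holes. -/
def erase (C : Ctx F V) : Ctx F V := C.subst fun _ => hole

theorem iff_of_forall_update {ι α : Type*} [Fintype ι] [DecidableEq ι] {Q : (ι → α) → Prop}
    {as bs : ι → α} (h : ∀ us i, us i = as i → (Q us ↔ Q (Function.update us i (bs i)))) :
    Q as ↔ Q bs := by
  suffices H : ∀ S : Finset ι, Q as ↔ Q fun i => if i ∈ S then bs i else as i by
    simpa using H Finset.univ
  intro S
  induction S using Finset.induction_on with
  | empty => simp
  | insert i S hi ih =>
    rw [ih, h _ i (by simp [hi])]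
    refine iff_of_eq (congrArg Q ?_)
    funext j
    by_cases hj : j = i
    · subst hj; simp
    · simp [hj]

/-- The predicate `P` varies in the induction so that it can absorb the surrounding function symbol
and the other arguments. -/
theorem iff_erase_of_forall_replaceAt {P : Ctx F V → Prop}
    (h : ∀ (x : V) (C : Ctx F V) (p : List ℕ), IsPos C p →
      (P (replaceAt C p (ctxVar x)) ↔ P (replaceAt C p hole))) (C : Ctx F V) :
    P C ↔ P (erase C) := by
  induction C generalizing P with
  | var y =>
    cases y with
    | none => exact Iff.rfl
    | some x =>
      have := h x hole [] ⟨_, subtermAt_nil _⟩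
      rwa [replaceAt_nil, replaceAt_nil] at this
  | func f Cs ih =>
    refine iff_of_forall_update (Q := fun us => P (.func f us)) (bs := fun i => erase (Cs i)) ?_
    intro us i hi
    have := ih i (P := fun D => P (.func f (Function.update us i D))) ?_
    · rwa [← hi, Function.update_eq_self, hi] at this
    · rintro x C p ⟨D, hD⟩
      have := h x (.func f (Function.update us i C)) (i :: p) ⟨D, by simpa using hD⟩
      simpa using this

theorem CondL2.mem_iff (h : CondL2 𝕃) {C D : Ctx F V} (hCD : erase C = erase D) :
    C ∈ 𝕃 ↔ D ∈ 𝕃 := by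
  have := fun C => iff_erase_of_forall_replaceAt (P := (· ∈ 𝕃)) h C
  rw [this C, this D, hCD]

open Classical in
/-- The max-top of a term. -/
noncomputable def maxTop (𝕃 : Set (Ctx F V)) (s : F.Term V) : Ctx F V :=
  if h : ∃ M ∈ 𝕃, Fits M s ∧ ∀ N ∈ 𝕃, Fits N s → Below N M then h.choose else hole

/-- A top of largest size is the greatest one: by (L3) at the root, its merge with another top is
again a top, and so cannot be larger. (L1) excludes the hole, and a variable top is the whole term.
-/
theorem IsLayerSystem.exists_maxTop (h : IsLayerSystem 𝕃) (s : F.Term V) :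
    ∃ M ∈ 𝕃, Fits M s ∧ ∀ N ∈ 𝕃, Fits N s → Below N M := by
  obtain ⟨T, ⟨hT, hTs⟩, hne⟩ := h.condL1 s
  let S : Set ℕ := {m | ∃ M ∈ 𝕃, Fits M s ∧ ctxSize M = m}
  have hbdd : BddAbove S :=
    ⟨ctxSize (toCtx s), by rintro _ ⟨M, _, hM, rfl⟩; exact Below.size_le hM⟩
  obtain ⟨M, hM, hMs, hsize⟩ := Nat.sSup_mem (s := S) ⟨_, T, hT, hTs, rfl⟩ hbdd
  have hmax : ∀ N ∈ 𝕃, Fits N s → ctxSize N ≤ ctxSize M := fun N hN hNs =>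
    hsize ▸ le_csSup hbdd ⟨N, hN, hNs, rfl⟩
  refine ⟨M, hM, hMs, fun N hN hNs => ?_⟩
  cases M with
  | var y =>
    cases y with
    | none => exact absurd ((Below.hole_below T).eq_of_size_le (hmax T hT hTs)).symm hne
    | some x =>
      obtain rfl := ctxVar_fits_iff.1 hMs
      exact hNs
  | func f Ms =>
    obtain ⟨E, hE, hEs⟩ := exists_isMerge hMs hNs
    have hmem := h.condL3 _ hM _ hN [] _ E ⟨_, f, Ms, subtermAt_nil _⟩ (subtermAt_nil _) hE
    rw [replaceAt_nil] at hmem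
    rw [hE.1.eq_of_size_le (hmax E hmem hEs)]
    exact hE.2.1

theorem IsLayerSystem.maxTop_spec (h : IsLayerSystem 𝕃) (s : F.Term V) :
    maxTop 𝕃 s ∈ 𝕃 ∧ Fits (maxTop 𝕃 s) s ∧ ∀ N ∈ 𝕃, Fits N s → Below N (maxTop 𝕃 s) := by
  have hs := h.exists_maxTop s
  rw [maxTop, dif_pos hs]
  exact hs.choose_spec

theorem IsLayerSystem.maxTop_mem (h : IsLayerSystem 𝕃) (s : F.Term V) : maxTop 𝕃 s ∈ 𝕃 :=
  (h.maxTop_spec s).1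

theorem IsLayerSystem.maxTop_fits (h : IsLayerSystem 𝕃) (s : F.Term V) : Fits (maxTop 𝕃 s) s :=
  (h.maxTop_spec s).2.1

theorem IsLayerSystem.below_maxTop (h : IsLayerSystem 𝕃) {N : Ctx F V} {s : F.Term V} (hN : N ∈ 𝕃)
    (hNs : Fits N s) : Below N (maxTop 𝕃 s) :=
  (h.maxTop_spec s).2.2 N hN hNs

theorem IsLayerSystem.maxTop_ne_hole (h : IsLayerSystem 𝕃) (s : F.Term V) :
    maxTop 𝕃 s ≠ hole := by
  obtain ⟨T, ⟨hT, hTs⟩, hne⟩ := h.condL1 s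
  intro e
  have := h.below_maxTop hT hTs
  rw [e] at this
  exact hne (below_hole_iff.1 this)

theorem IsLayerSystem.isMaxTop_iff (h : IsLayerSystem 𝕃) {M : Ctx F V} {s : F.Term V} :
    IsMaxTop 𝕃 M (toCtx s) ↔ M = maxTop 𝕃 s := by
  constructor
  · rintro ⟨⟨hM, hMs⟩, hmax⟩
    exact (hmax _ ⟨h.maxTop_mem s, h.maxTop_fits s⟩ (h.below_maxTop hM hMs)).symm
  · rintro rfl
    exact ⟨⟨h.maxTop_mem s, h.maxTop_fits s⟩,
      fun N hN hMN => (h.below_maxTop hN.1 hN.2).antisymm hMN⟩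

/-- The term `s` in which the subterms at the holes of its max-top have been hidden. -/
noncomputable def aliens (𝕃 : Set (Ctx F V)) (s : F.Term V) : LTerm F V :=
  labelHoles (maxTop 𝕃 s) s

theorem IsLayerSystem.val_aliens (h : IsLayerSystem 𝕃) (s : F.Term V) : val (aliens 𝕃 s) = s :=
  (h.maxTop_fits s).val_labelHoles

theorem shape_aliens (s : F.Term V) : shape (aliens 𝕃 s) = maxTop 𝕃 s := shape_labelHoles _ _

theorem IsLayerSystem.aliens_ne (h : IsLayerSystem 𝕃) (s a : F.Term V) :
    aliens 𝕃 s ≠ .var (Sum.inr a) := by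
  intro e
  have := congrArg shape e
  rw [shape_aliens] at this
  exact h.maxTop_ne_hole s this

/-- The rank of `t` is at most `k`. -/
def RankLE (𝕃 : Set (Ctx F V)) : ℕ → F.Term V → Prop
  | 0, _ => False
  | k + 1, t => ∀ a, Sum.inr a ∈ vars (aliens 𝕃 t) → RankLE 𝕃 k a

theorem RankLE.succ {k : ℕ} {t : F.Term V} (h : RankLE 𝕃 k t) : RankLE 𝕃 (k + 1) t := by
  induction k generalizing t with
  | zero => exact h.elim
  | succ k ih => exact fun a ha => ih (h a ha)

theorem RankLE.mono {k l : ℕ} {t : F.Term V} (h : RankLE 𝕃 k t) (hkl : k ≤ l) : RankLE 𝕃 l t := by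
  induction hkl with
  | refl => exact h
  | step _ ih => exact ih.succ

/-- The size of a term. -/
def termSize {X : Type*} : F.Term X → ℕ
  | .var _ => 1
  | .func _ ts => 1 + ∑ i, termSize (ts i)

theorem termSize_le_of_mem_vars {E : LTerm F V} {a : F.Term V} (h : Sum.inr a ∈ vars E) :
    termSize a ≤ termSize (val E) := by
  induction E with
  | var y => rw [← mem_vars_var.1 h]; exact le_rfl
  | func f ts ih =>
    obtain ⟨i, hi⟩ := mem_vars_func.1 h
    have h2 := Finset.single_le_sum (f := fun i => termSize (val (ts i)))
      (fun i _ => Nat.zero_le _) (Finset.mem_univ i)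
    have h3 : termSize (val (.func f ts)) = 1 + ∑ i, termSize (val (ts i)) := rfl
    have := ih i hi
    beta_reduce at h2
    omega

theorem termSize_lt_of_mem_vars {E : LTerm F V} {a : F.Term V} (h : Sum.inr a ∈ vars E)
    (hE : ∀ a, E ≠ .var (Sum.inr a)) : termSize a < termSize (val E) := by
  cases E with
  | var y => exact absurd (by rw [← mem_vars_var.1 h]) (hE a)
  | func f ts =>
    obtain ⟨i, hi⟩ := mem_vars_func.1 h
    have h2 := Finset.single_le_sum (f := fun i => termSize (val (ts i)))
      (fun i _ => Nat.zero_le _) (Finset.mem_univ i)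
    have h3 : termSize (val (.func f ts)) = 1 + ∑ i, termSize (val (ts i)) := rfl
    have := termSize_le_of_mem_vars hi
    beta_reduce at h2
    omega

/-- Aliens are proper subterms because the max-top is not a hole. Thus the induction on the rank
reaches every term. -/
theorem IsLayerSystem.rankLE_termSize (h : IsLayerSystem 𝕃) (t : F.Term V) :
    RankLE 𝕃 (termSize t) t := by
  obtain ⟨k, hk⟩ : ∃ k, termSize t ≤ k := ⟨_, le_rfl⟩
  suffices H : ∀ k (t : F.Term V), termSize t ≤ k → RankLE 𝕃 k t from H _ t le_rfl
  clear! k t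
  intro k
  induction k with
  | zero => intro t ht; cases t <;> simp [termSize] at ht
  | succ k ih =>
    intro t ht a ha
    have := termSize_lt_of_mem_vars ha fun a => h.aliens_ne t a
    rw [h.val_aliens] at this
    exact ih a (by omega)

/-- Both sides say that the max-top has no holes, since no term has rank `0`. -/
theorem hasRank_one_iff (h : IsLayerSystem 𝕃) {t : F.Term V} : HasRank 𝕃 t 1 ↔ RankLE 𝕃 1 t := by
  constructor
  · intro ht a ha
    generalize hm : 1 = m at ht
    cases ht with
    | @intro _ M k m hM hk hle _ =>
      obtain rfl := h.isMaxTop_iff.1 hM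
      obtain ⟨p, hp⟩ := exists_pos_of_mem_vars ha
      have h1 : subtermAt (maxTop 𝕃 t) p = some hole := by
        rw [← shape_aliens]; exact subtermAt_subst hp _
      have h2 : subtermAt t p = some a := by
        have := subtermAt_subst hp (Sum.elim .var id)
        rwa [show (aliens 𝕃 t).subst _ = t from h.val_aliens t] at this
      have h3 := hk p a h1 h2
      have h4 := hle p h1
      generalize k p = j at h3 h4
      cases h3
      omega
  · intro ht
    have hno : ∀ p, subtermAt (maxTop 𝕃 t) p ≠ some hole := by
      intro p hp
      obtain ⟨a, ha, _⟩ := (h.maxTop_fits t).exists_subtermAt hp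
      have := subtermAt_labelHoles hp ha
      exact ht a (vars_subterm_subset this rfl)
    exact .intro (M := maxTop 𝕃 t) (k := fun _ => 0) (m := 0) (h.isMaxTop_iff.2 rfl)
      (fun p a hp => (hno p hp).elim) (fun p hp => le_rfl) (Or.inl rfl)

/-- By (L3) the merge of `K` with the max-top of `b` can be grafted into the max-top of `t`. The
result still fits `t`, so maximality puts the merge below `K`. -/
theorem IsLayerSystem.maxTop_below_subterm (h : IsLayerSystem 𝕃) {t b : F.Term V} {K : Ctx F V}
    {q : List ℕ} (hK : subtermAt (maxTop 𝕃 t) q = some K) (hb : subtermAt t q = some b)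
    (hne : K ≠ hole) : Below (maxTop 𝕃 b) K := by
  obtain ⟨b', hb', hKb⟩ := (h.maxTop_fits t).exists_subtermAt hK
  obtain rfl : b' = b := Option.some.inj (hb'.symm.trans hb)
  cases K with
  | var y =>
    cases y with
    | none => exact absurd rfl hne
    | some x =>
      obtain rfl := ctxVar_fits_iff.1 hKb
      exact h.maxTop_fits _
  | func f Ks =>
    obtain ⟨E, hE, hEb⟩ := exists_isMerge hKb (h.maxTop_fits b')
    have hmem := h.condL3 _ (h.maxTop_mem t) _ (h.maxTop_mem b') q _ E ⟨_, f, Ks, hK⟩ hK hE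
    have hfit : Fits (replaceAt (maxTop 𝕃 t) q E) t := (h.maxTop_fits t).replaceAt hK hb hEb
    exact hE.2.1.trans ((h.below_maxTop hmem hfit).of_replaceAt hK hK)

/-- The path to the hole of `K` labelled `c` must meet a hole of the smaller context `N`; `q` is the
position of that hole. -/
theorem exists_of_mem_vars_labelHoles {N K : Ctx F V} {b c : F.Term V} (hNK : Below N K)
    (hK : Fits K b) (hc : Sum.inr c ∈ vars (labelHoles K b)) :
    ∃ q K' b', subtermAt K q = some K' ∧ subtermAt b q = some b' ∧
      Sum.inr b' ∈ vars (labelHoles N b) ∧ Sum.inr c ∈ vars (labelHoles K' b') := by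
  induction N generalizing K b with
  | var y =>
    cases y with
    | none => exact ⟨[], K, b, by simp, by simp, rfl, hc⟩
    | some x =>
      obtain rfl := ctxVar_below_iff.1 hNK
      simp at hc
  | func f Ns ih =>
    obtain ⟨Ks, rfl, hNK'⟩ := func_below_iff.1 hNK
    obtain ⟨bs, rfl, hK'⟩ := func_fits_iff.1 hK
    simp only [labelHoles_func, mem_vars_func] at hc
    obtain ⟨i, hi⟩ := hc
    obtain ⟨q, K', b', h1, h2, h3, h4⟩ := ih i (hNK' i) (hK' i) hi
    refine ⟨i :: q, K', b', by simpa using h1, by simpa using h2, ?_, h4⟩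
    simp only [labelHoles_func, mem_vars_func]
    exact ⟨i, h3⟩

/-- As `K` contains the max-top of `b`, the term `c` lies within an alien `c'` of `b`, of rank at
most `k`. Either `c = c'`, or `K` also covers the top of `c'` and the argument is repeated there
with a smaller rank. -/
theorem IsLayerSystem.rankLE_of_mem_vars_labelHoles (h : IsLayerSystem 𝕃) {k : ℕ}
    {t b c : F.Term V} {K : Ctx F V} {q : List ℕ} (hK : subtermAt (maxTop 𝕃 t) q = some K)
    (hb : subtermAt t q = some b) (hne : K ≠ hole) (hrank : RankLE 𝕃 (k + 1) b)
    (hc : Sum.inr c ∈ vars (labelHoles K b)) : RankLE 𝕃 k c := by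
  induction k generalizing q b K with
  | zero =>
    obtain ⟨b', hb', hKb⟩ := (h.maxTop_fits t).exists_subtermAt hK
    obtain rfl := Option.some.inj (hb'.symm.trans hb)
    obtain ⟨q', K', c', h1, h2, h3, h4⟩ :=
      exists_of_mem_vars_labelHoles (h.maxTop_below_subterm hK hb hne) hKb hc
    exact (hrank c' h3).elim
  | succ k ih =>
    obtain ⟨b', hb', hKb⟩ := (h.maxTop_fits t).exists_subtermAt hK
    obtain rfl := Option.some.inj (hb'.symm.trans hb)
    obtain ⟨q', K', c', h1, h2, h3, h4⟩ :=
      exists_of_mem_vars_labelHoles (h.maxTop_below_subterm hK hb hne) hKb hc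
    have hc' := hrank c' h3
    by_cases hK' : K' = hole
    · subst hK'
      simp only [labelHoles_hole, mem_vars_var, Sum.inr.injEq] at h4
      rwa [h4]
    · refine (ih (q := q ++ q') ?_ ?_ hK' hc' h4).succ
      · rw [subtermAt_append, hK]; exact h1
      · rw [subtermAt_append, hb]; exact h2

end LayerSystems

/-! ### How the max-top changes when aliens are replaced. -/

section Expansion

variable {F : FirstOrder.Language.{u, v}} {V : Type w} {𝕃 : Set (Ctx F V)}

/-- `E` arises from `D` by replacing some of its labels by labels that satisfy `P`. -/
inductive Retagged (P : F.Term V → Prop) : LTerm F V → LTerm F V → Prop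
  | inl (x : V) : Retagged P (.var (Sum.inl x)) (.var (Sum.inl x))
  | inr {a b : F.Term V} : a = b ∨ P b → Retagged P (.var (Sum.inr a)) (.var (Sum.inr b))
  | func {n : ℕ} (f : F.Functions n) {Ds Es : Fin n → LTerm F V} :
      (∀ i, Retagged P (Ds i) (Es i)) → Retagged P (.func f Ds) (.func f Es)

theorem Retagged.refl (P : F.Term V → Prop) (E : LTerm F V) : Retagged P E E := by
  induction E with
  | var y =>
    cases y with
    | inl x => exact .inl x
    | inr a => exact .inr (Or.inl rfl)
  | func f Es ih => exact .func f ih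

theorem Retagged.shape_eq {P : F.Term V → Prop} {D E : LTerm F V} (h : Retagged P D E) :
    shape D = shape E := by
  induction h with
  | inl x => rfl
  | inr _ => rfl
  | func f _ ih =>
    simp only [shape, subst_func_eq] at ih ⊢
    congr 1
    funext i
    exact ih i

theorem retagged_replaceAt {P : F.Term V → Prop} {E : LTerm F V} {a b : F.Term V} {q : List ℕ}
    (ha : subtermAt E q = some (.var (Sum.inr a))) (hb : P b) :
    Retagged P E (replaceAt E q (.var (Sum.inr b))) := by
  induction q generalizing E with
  | nil =>
    rw [subtermAt_nil] at ha
    obtain rfl := Option.some.inj ha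
    rw [replaceAt_nil]
    exact .inr (Or.inr hb)
  | cons j q ih =>
    obtain ⟨n, f, Es, i, rfl, rfl, hi⟩ := exists_func_of_subtermAt_cons ha
    rw [replaceAt_func_cons]
    refine .func f fun k => ?_
    by_cases hk : k = i
    · subst hk; simpa using ih hi
    · simpa [hk] using Retagged.refl P _

theorem retagged_subst {P : F.Term V → Prop} {E : LTerm F V} {φ : F.Term V → F.Term V}
    (h : ∀ a, Sum.inr a ∈ vars E → a = φ a ∨ P (φ a)) :
    Retagged P E
      (E.subst (Sum.elim (fun x => .var (Sum.inl x)) fun a => .var (Sum.inr (φ a)))) := by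
  induction E with
  | var y =>
    cases y with
    | inl x => exact .inl x
    | inr a => exact .inr (h a rfl)
  | func f Es ih => exact .func f fun i => ih i fun a ha => h a (mem_vars_func.2 ⟨i, ha⟩)

/-- `Z` arises from `E` by expanding some of the labels that satisfy `P`. The labels in the
expansion of `b` have smaller rank than `b`. -/
inductive Expanded (𝕃 : Set (Ctx F V)) (P : F.Term V → Prop) : LTerm F V → LTerm F V → Prop
  | inl (x : V) : Expanded 𝕃 P (.var (Sum.inl x)) (.var (Sum.inl x))
  | keep (b : F.Term V) : Expanded 𝕃 P (.var (Sum.inr b)) (.var (Sum.inr b))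
  | expand {b : F.Term V} {Z : LTerm F V} : P b → val Z = b →
      (∀ k, RankLE 𝕃 (k + 1) b → ∀ c, Sum.inr c ∈ vars Z → RankLE 𝕃 k c) →
      Expanded 𝕃 P (.var (Sum.inr b)) Z
  | func {n : ℕ} (f : F.Functions n) {Es Zs : Fin n → LTerm F V} :
      (∀ i, Expanded 𝕃 P (Es i) (Zs i)) → Expanded 𝕃 P (.func f Es) (.func f Zs)

theorem Retagged.expanded_labelHoles {P : F.Term V → Prop} {D E : LTerm F V} {K : Ctx F V}
    (hE : Retagged P D E) (hK : Below (shape E) K) (hfit : Fits K (val E))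
    (H : ∀ q a b K', subtermAt D q = some (.var (Sum.inr a)) →
      subtermAt E q = some (.var (Sum.inr b)) → subtermAt K q = some K' → K' = hole ∨
        a ≠ b ∧ ∀ k, RankLE 𝕃 (k + 1) b →
          ∀ c, Sum.inr c ∈ vars (labelHoles K' b) → RankLE 𝕃 k c) :
    Expanded 𝕃 P E (labelHoles K (val E)) := by
  induction hE generalizing K with
  | inl x =>
    obtain rfl := ctxVar_below_iff.1 hK
    exact .inl x
  | @inr a b hab =>
    rcases H [] a b K (subtermAt_nil _) (subtermAt_nil _) (subtermAt_nil _) with rfl | ⟨hne, h⟩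
    · exact .keep b
    · exact .expand (hab.resolve_left hne) hfit.val_labelHoles h
  | @func n f Ds Es _ ih =>
    obtain ⟨Ks, rfl, hK'⟩ := func_below_iff.1 hK
    obtain ⟨ts, hts, hfit'⟩ := func_fits_iff.1 hfit
    have hval : val (.func f Es) = .func f fun i => val (Es i) := rfl
    rw [hval] at hts ⊢
    cases hts
    rw [labelHoles_func]
    refine .func f fun i => ih i (hK' i) (hfit' i) fun q a b K' h1 h2 h3 => ?_
    exact H (i :: q) a b K' (by simpa using h1) (by simpa using h2) (by simpa using h3)

/-- The old max-top is a layer that fits the new term, so the new max-top can only extend it into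
the holes. It remains to see that it enters changed holes only, and there the rank drops. -/
theorem IsLayerSystem.expanded_aliens (h : IsLayerSystem 𝕃) (hC2 : CondC2 𝕃)
    {P : F.Term V → Prop} {s : F.Term V} {E : LTerm F V} (hE : Retagged P (aliens 𝕃 s) E) :
    Expanded 𝕃 P E (aliens 𝕃 (val E)) := by
  have hshape : shape E = maxTop 𝕃 s := by rw [← hE.shape_eq, shape_aliens]
  have hbelow : Below (shape E) (maxTop 𝕃 (val E)) :=
    h.below_maxTop (hshape ▸ h.maxTop_mem s) (shape_fits_val E)
  refine hE.expanded_labelHoles hbelow (h.maxTop_fits _) fun q a b K' h1 h2 h3 => ?_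
  by_cases hK' : K' = hole
  · exact Or.inl hK'
  have hMq : subtermAt (maxTop 𝕃 s) q = some hole := by
    rw [← shape_aliens]; exact subtermAt_subst h1 _
  have hsq : subtermAt s q = some a := by
    have := subtermAt_subst h1 (Sum.elim .var id)
    rwa [show (aliens 𝕃 s).subst _ = s from h.val_aliens s] at this
  have htq : subtermAt (val E) q = some b := subtermAt_subst h2 _
  refine Or.inr ⟨?_, fun k hk c hc => h.rankLE_of_mem_vars_labelHoles h3 htq hK' hk hc⟩
  -- If the label is unchanged, (C2) allows `K'` to be grafted onto the max-top of `s`. The result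
  -- still fits `s`, so maximality makes `K'` a hole.
  rintro rfl
  obtain ⟨b', hb', hKb⟩ := (h.maxTop_fits _).exists_subtermAt h3
  obtain rfl := Option.some.inj (hb'.symm.trans htq)
  have hmem := hC2 _ (h.maxTop_mem s) _ (h.maxTop_mem (val E)) (hshape ▸ hbelow) q K' hMq h3
  have hfit : Fits (replaceAt (maxTop 𝕃 s) q K') s := (h.maxTop_fits s).replaceAt hMq hsq hKb
  exact hK' (below_hole_iff.1 ((h.below_maxTop hmem hfit).of_replaceAt hMq hMq))

theorem Expanded.rankLE {P : F.Term V → Prop} {k : ℕ} {E Z : LTerm F V}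
    (h : Expanded 𝕃 P E Z) (hP : ∀ b, P b → RankLE 𝕃 (k + 1) b) {c : F.Term V}
    (hc : Sum.inr c ∈ vars Z) : Sum.inr c ∈ vars E ∨ RankLE 𝕃 k c := by
  induction h with
  | inl x => exact Or.inl hc
  | keep b => exact Or.inl hc
  | expand hb _ hZ => exact Or.inr (hZ k (hP _ hb) c hc)
  | func f _ ih =>
    obtain ⟨i, hi⟩ := mem_vars_func.1 hc
    exact (ih i hi).imp_left fun h => mem_vars_func.2 ⟨i, h⟩

end Expansion

/-! ### Rewrite steps in the max-top and in aliens. -/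

section Layered

variable {F : FirstOrder.Language.{u, v}} {V : Type w} {𝕃 : Set (Ctx F V)} {R : TRS F V}

theorem Fits.isFunPos_or {M : Ctx F V} {s : F.Term V} {p : List ℕ} (h : Fits M s)
    (hp : IsFunPos s p) : IsFunPos M p ∨ ∃ q p', p = q ++ p' ∧ subtermAt M q = some hole := by
  induction p generalizing M s with
  | nil =>
    cases M with
    | var y =>
      cases y with
      | none => exact Or.inr ⟨[], [], rfl, subtermAt_nil _⟩
      | some x =>
        obtain rfl := ctxVar_fits_iff.1 h
        exact (not_isFunPos_var x hp).elim
    | func f Ms => exact Or.inl ⟨_, f, Ms, subtermAt_nil _⟩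
  | cons j p ih =>
    cases M with
    | var y =>
      cases y with
      | none => exact Or.inr ⟨[], j :: p, rfl, subtermAt_nil _⟩
      | some x =>
        obtain rfl := ctxVar_fits_iff.1 h
        exact (not_isFunPos_var x hp).elim
    | func f Ms =>
      obtain ⟨ts, rfl, h'⟩ := func_fits_iff.1 h
      obtain ⟨m, g, us, hp⟩ := hp
      obtain ⟨n, f', ts', i, he, rfl, hi⟩ := exists_func_of_subtermAt_cons hp
      cases he
      rcases ih (h' i) ⟨m, g, us, hi⟩ with ⟨m', g', us', h1⟩ | ⟨q, p', rfl, h1⟩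
      · exact Or.inl ⟨m', g', us', by simpa using h1⟩
      · exact Or.inr ⟨i :: q, p', rfl, by simpa using h1⟩

/-- By (W) the rule matches the max-top as well as `s`, and the two matches combine into a match of
the labelled term. By (C1) the result is either `t` with its own aliens as labels or a collapse to a
single label. -/
theorem IsLayered.step_maxTop (h : IsLayered 𝕃 R) {ρ : Rule F V} (hρ : ρ ∈ R) {s t : F.Term V}
    {p : List ℕ} (hst : StepAt ρ p s t) (hp : IsFunPos (maxTop 𝕃 s) p) :
    ∃ D, StepAt ρ p (aliens 𝕃 s) D ∧ val D = t ∧ (D = aliens 𝕃 t ∨ D = .var (Sum.inr t)) := by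
  have hM := h.isLayerSystem.isMaxTop_iff.2 (rfl : maxTop 𝕃 s = _)
  obtain ⟨L, hL, hML⟩ := h.condW ρ hρ s t _ p hM hp hst
  have hC1 := h.condC1 ρ hρ s t _ p hM hp hst L hL hML
  rw [h.isLayerSystem.isMaxTop_iff] at hC1
  have hD : labelHoles L t = aliens 𝕃 t ∨ labelHoles L t = .var (Sum.inr t) := by
    rcases hC1 with rfl | rfl
    · exact Or.inl rfl
    · exact Or.inr rfl
  refine ⟨labelHoles L t, ?_, ?_, hD⟩
  · obtain ⟨σ, h1, rfl⟩ := hst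
    obtain ⟨τ, h2, rfl⟩ := hML
    refine ⟨fun x => labelHoles (τ x) (σ x), ?_, ?_⟩
    · rw [aliens, subtermAt_labelHoles h2 h1, labelHoles_subst]
    · rw [aliens, replaceAt_labelHoles (h.isLayerSystem.maxTop_fits s) h2 h1, labelHoles_subst]
  · rcases hD with hD | hD <;> rw [hD]
    · exact h.isLayerSystem.val_aliens t
    · rfl

theorem IsLayerSystem.step_alien (h : IsLayerSystem 𝕃) {ρ : Rule F V} {s t : F.Term V}
    {q p : List ℕ} (hst : StepAt ρ (q ++ p) s t) (hq : subtermAt (maxTop 𝕃 s) q = some hole) :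
    ∃ a b, subtermAt (aliens 𝕃 s) q = some (.var (Sum.inr a)) ∧ StepAt ρ p a b ∧
      t = val (replaceAt (aliens 𝕃 s) q (.var (Sum.inr b))) := by
  obtain ⟨a, ha, _⟩ := (h.maxTop_fits s).exists_subtermAt hq
  have ha' : subtermAt (aliens 𝕃 s) q = some (.var (Sum.inr a)) := subtermAt_labelHoles hq ha
  obtain ⟨b, hb, rfl⟩ := hst.of_append ha
  refine ⟨a, b, ha', hb, ?_⟩
  rw [val, replaceAt_subst ha' _ _, show (aliens 𝕃 s).subst _ = s from h.val_aliens s]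
  rfl

/-- A step in the max-top creates no new aliens, unless the term collapses to one of its old aliens.
A step in an alien does not raise the rank of that alien, and expanding it leaves only labels of
smaller rank. -/
theorem IsLayered.rankLE_step (h : IsLayered 𝕃 R) {k : ℕ} {s t : F.Term V} (hs : RankLE 𝕃 k s)
    (hst : Rewrites R s t) : RankLE 𝕃 k t := by
  induction k generalizing s t with
  | zero => exact hs.elim
  | succ k ih =>
    obtain ⟨ρ, hρ, p, hst⟩ := hst
    rcases (h.isLayerSystem.maxTop_fits s).isFunPos_or hst.isFunPos with hp | ⟨q, p', rfl, hq⟩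
    · obtain ⟨D, hD, rfl, h' | h'⟩ := h.step_maxTop hρ hst hp
      · exact fun a ha => hs a (hD.vars_subset (h' ▸ ha))
      · exact (hs _ (hD.vars_subset (h' ▸ rfl))).succ
    · obtain ⟨a, b, ha, hab, rfl⟩ := h.isLayerSystem.step_alien hst hq
      have hb : RankLE 𝕃 k b := ih (hs a (vars_subterm_subset ha rfl)) ⟨ρ, hρ, p', hab⟩
      intro c hc
      have hE := h.isLayerSystem.expanded_aliens h.condC2
        (retagged_replaceAt (P := RankLE 𝕃 k) ha hb)
      rcases hE.rankLE (fun b hb => hb.succ) hc with hc | hc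
      · rcases vars_replaceAt_subset ha _ hc with hc | hc
        · exact hs c hc
        · rw [mem_vars_var] at hc
          cases hc
          exact hb
      · exact hc

theorem IsLayered.rankLE_reduces (h : IsLayered 𝕃 R) {k : ℕ} {s t : F.Term V}
    (hs : RankLE 𝕃 k s) (hst : Reduces R s t) : RankLE 𝕃 k t := by
  induction hst with
  | refl => exact hs
  | tail _ hst ih => exact h.rankLE_step ih hst

end Layered

/-! ### The base of a term and its confluence. -/

section Base

variable {F : FirstOrder.Language.{u, v}} {V : Type w} {𝕃 : Set (Ctx F V)} {R : TRS F V} {m : ℕ}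

theorem unlabelled_subst {Y : Type*} (t : F.Term V) (θ : V ⊕ F.Term V → F.Term Y) :
    (unlabelled t).subst θ = t.subst fun x => θ (Sum.inl x) := by
  rw [unlabelled, subst_subst]; rfl

theorem inr_notMem_vars_unlabelled {t a : F.Term V} : Sum.inr a ∉ vars (unlabelled t) := by
  intro h
  obtain ⟨x, _, hx⟩ := mem_vars_subst.1 h
  cases hx

open Classical in
/-- Make the labels of rank at most `m` transparent. -/
noncomputable def unfoldLabels (𝕃 : Set (Ctx F V)) (m : ℕ) (E : LTerm F V) : LTerm F V :=
  E.subst (Sum.elim (fun x => .var (Sum.inl x))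
    fun a => if RankLE 𝕃 m a then unlabelled a else .var (Sum.inr a))

theorem unfoldLabels_inr_of_rankLE {a : F.Term V} (h : RankLE 𝕃 m a) :
    unfoldLabels 𝕃 m (.var (Sum.inr a)) = unlabelled a := by
  simp [unfoldLabels, h]

theorem unfoldLabels_inr_of_not_rankLE {a : F.Term V} (h : ¬ RankLE 𝕃 m a) :
    unfoldLabels 𝕃 m (.var (Sum.inr a)) = .var (Sum.inr a) := by
  simp [unfoldLabels, h]

theorem val_unfoldLabels (E : LTerm F V) : val (unfoldLabels 𝕃 m E) = val E := by
  rw [val, unfoldLabels, subst_subst]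
  refine subst_congr fun y _ => ?_
  cases y with
  | inl x => rfl
  | inr a =>
    by_cases h : RankLE 𝕃 m a
    · simp only [Sum.elim_inr, h, if_true]
      exact val_unlabelled a
    · simp [h]

theorem inr_mem_vars_unfoldLabels {E : LTerm F V} {c : F.Term V}
    (h : Sum.inr c ∈ vars (unfoldLabels 𝕃 m E)) :
    Sum.inr c ∈ vars E ∧ ¬ RankLE 𝕃 m c := by
  obtain ⟨y, hy, hc⟩ := mem_vars_subst.1 h
  cases y with
  | inl x => cases hc
  | inr a =>
    by_cases ha : RankLE 𝕃 m a
    · simp only [Sum.elim_inr, ha, if_true] at hc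
      exact (inr_notMem_vars_unlabelled hc).elim
    · simp only [Sum.elim_inr, ha, if_false, mem_vars_var, Sum.inr.injEq] at hc
      subst hc
      exact ⟨hy, ha⟩

theorem unfoldLabels_eq_unlabelled {E : LTerm F V} (h : ∀ a, Sum.inr a ∈ vars E → RankLE 𝕃 m a) :
    unfoldLabels 𝕃 m E = unlabelled (val E) := by
  rw [unfoldLabels, unlabelled, val, subst_subst]
  refine subst_congr fun y hy => ?_
  cases y with
  | inl x => rfl
  | inr a => simp [h a hy, unlabelled]

/-- The term `s` in which the subterms at the holes of its max-top that have rank greater than `m`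
have been hidden. -/
noncomputable def base (𝕃 : Set (Ctx F V)) (m : ℕ) (s : F.Term V) : LTerm F V :=
  unfoldLabels 𝕃 m (aliens 𝕃 s)

theorem IsLayerSystem.val_base (h : IsLayerSystem 𝕃) (s : F.Term V) : val (base 𝕃 m s) = s := by
  rw [base, val_unfoldLabels, h.val_aliens]

theorem IsLayerSystem.base_eq_unlabelled (h : IsLayerSystem 𝕃) {s : F.Term V}
    (hs : RankLE 𝕃 (m + 1) s) : base 𝕃 m s = unlabelled s := by
  rw [base, unfoldLabels_eq_unlabelled hs, h.val_aliens]

theorem rankLE_of_mem_vars_base {k : ℕ} {s a : F.Term V} (hs : RankLE 𝕃 (k + 1) s)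
    (ha : Sum.inr a ∈ vars (base 𝕃 m s)) : RankLE 𝕃 k a :=
  hs a (inr_mem_vars_unfoldLabels ha).1

/-- Any two reducts of `t` have a common reduct. -/
def ConfluentAt {X : Type*} (R : TRS F V) (t : F.Term X) : Prop :=
  ∀ b c, Reduces R t b → Reduces R t c → ∃ d, Reduces R b d ∧ Reduces R c d

theorem exists_injOn_avoiding {α β : Type*} [Infinite β] {A : Set α} (hA : A.Finite) {W : Set β}
    (hW : W.Finite) : ∃ g : α → β, Set.InjOn g A ∧ ∀ a ∈ A, g a ∉ W := by
  obtain ⟨f, hf⟩ := Set.countable_iff_exists_injOn.1 hA.countable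
  have e := hW.infinite_compl.natEmbedding
  exact ⟨fun a => e (f a), fun a ha b hb hab => hf ha hb (e.injective (Subtype.ext hab)),
    fun a _ => (e (f a)).2⟩

/-- Reopening the positions of the variables `g a` in `N` as holes gives `N'`. Erasure does not
distinguish variables from holes, so (L2) makes `N'` a layer when `N` is one. -/
theorem exists_context_between {E : LTerm F V} {S : F.Term V → Prop} [DecidablePred S]
    {g : F.Term V → V} {N : Ctx F V}
    (h1 : Below (E.subst (Sum.elim ctxVar fun a => if S a then hole else ctxVar (g a))) N)
    (h2 : Fits N (E.subst (Sum.elim .var fun a => if S a then a else .var (g a)))) :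
    ∃ N', Below (shape E) N' ∧ Fits N' (val E) ∧ erase N' = erase N ∧
      (N' = shape E →
        N = E.subst (Sum.elim ctxVar fun a => if S a then hole else ctxVar (g a))) := by
  induction E generalizing N with
  | var y =>
    cases y with
    | inl x =>
      obtain rfl := ctxVar_below_iff.1 h1
      exact ⟨_, .refl _, .refl _, rfl, fun _ => rfl⟩
    | inr a =>
      by_cases ha : S a
      · simp only [subst_var_eq, Sum.elim_inr, ha, if_true] at h1 h2 ⊢
        exact ⟨N, h1, h2, rfl, id⟩
      · simp only [subst_var_eq, Sum.elim_inr, ha, if_false] at h1 h2 ⊢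
        obtain rfl := ctxVar_below_iff.1 h1
        exact ⟨hole, .refl _, .hole_below _, rfl, fun _ => rfl⟩
  | func f Es ih =>
    obtain ⟨Ns, rfl, h1'⟩ := func_below_iff.1 h1
    obtain ⟨ts, hts, h2'⟩ := func_fits_iff.1 h2
    cases hts
    choose Ns' hN1 hN2 hN3 hN4 using fun i => ih i (h1' i) (h2' i)
    refine ⟨.func f Ns', .mono f hN1, func_fits_iff.2 ⟨_, rfl, hN2⟩, ?_, fun e => ?_⟩
    · simp only [erase, subst_func_eq] at hN3 ⊢
      congr 1
      funext i
      exact hN3 i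
    · rw [subst_func_eq]
      congr 1
      funext i
      refine hN4 i ?_
      simp only [shape, subst_func_eq, FirstOrder.Language.Term.func.injEq, heq_eq_eq,
        true_and] at e
      exact congrFun e i

-- By (L2) the max-top of `s`, with variables in the holes of high rank, is still a layer. A larger
-- top of the new term would yield a larger top of `s`, so it is the max-top of the new term, and
-- only the aliens of rank at most `m` are left. Neither freshness nor injectivity of `g` is needed.
open Classical in
theorem IsLayerSystem.rankLE_base_subst (h : IsLayerSystem 𝕃) (s : F.Term V) (g : F.Term V → V) :
    RankLE 𝕃 (m + 1) ((base 𝕃 m s).subst (Sum.elim .var fun a => .var (g a))) := by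
  set E := aliens 𝕃 s with hE
  set σ : V ⊕ F.Term V → Ctx F V :=
    Sum.elim ctxVar fun a => if RankLE 𝕃 m a then hole else ctxVar (g a) with hσ
  set τ : V ⊕ F.Term V → F.Term V :=
    Sum.elim .var fun a => if RankLE 𝕃 m a then a else .var (g a) with hτ
  have hs' : (base 𝕃 m s).subst (Sum.elim .var fun a => .var (g a)) = E.subst τ := by
    rw [base, unfoldLabels, subst_subst]
    refine subst_congr fun y _ => ?_
    cases y with
    | inl x => rfl
    | inr a =>
      by_cases ha : RankLE 𝕃 m a
      · simp only [hτ, Sum.elim_inr, ha, if_true, unlabelled_subst, Sum.elim_inl]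
        exact subst_var a
      · simp [hτ, ha]
  rw [hs']
  have herase : erase (E.subst σ) = erase (shape E) := by
    rw [erase, erase, shape, subst_subst, subst_subst]
    refine subst_congr fun y _ => ?_
    cases y with
    | inl x => rfl
    | inr a => by_cases ha : RankLE 𝕃 m a <;> simp [hσ, ha, hole, ctxVar]
  have hmem : E.subst σ ∈ 𝕃 := by
    rw [h.condL2.mem_iff herase, hE, shape_aliens]
    exact h.maxTop_mem s
  have hfit : Fits (E.subst σ) (E.subst τ) := by
    rw [Fits, toCtx_eq_subst, subst_subst]
    clear_value E
    clear hE hs' herase hmem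
    induction E with
    | var y =>
      cases y with
      | inl x => exact .refl _
      | inr a =>
        by_cases ha : RankLE 𝕃 m a
        · simpa [hσ, ha] using Below.hole_below _
        · simpa [hσ, hτ, ha] using Below.refl _
    | func f Es ih => exact .mono f ih
  obtain ⟨N', h1, h2, h3, h4⟩ := exists_context_between (h.below_maxTop hmem hfit)
    (h.maxTop_fits (E.subst τ))
  have hN' : N' ∈ 𝕃 := (h.condL2.mem_iff h3).2 (h.maxTop_mem _)
  rw [hE, h.val_aliens] at h2
  have hN : N' = shape E :=
    Below.antisymm (by rw [hE, shape_aliens]; exact h.below_maxTop hN' h2) h1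
  have hmax := h4 hN
  intro a ha
  rw [aliens, hmax, labelHoles_subst] at ha
  obtain ⟨y, _, hy⟩ := mem_vars_subst.1 ha
  cases y with
  | inl x => simp [hτ] at hy
  | inr b =>
    by_cases hb : RankLE 𝕃 m b
    · simp only [hτ, Sum.elim_inr, hb, if_true, labelHoles_hole, mem_vars_var,
        Sum.inr.injEq] at hy
      rwa [hy]
    · simp [hτ, hb] at hy

/-- Labels are renamed injectively to fresh variables by `η` and back by `ζ`. Reductions create no
new variables, so the reducts are recovered as well. -/
theorem IsLayerSystem.confluentAt_base [Infinite V] (h : IsLayerSystem 𝕃)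
    (hconf : ∀ t : F.Term V, RankLE 𝕃 (m + 1) t → ConfluentAt R t) (s : F.Term V) :
    ConfluentAt R (base 𝕃 m s) := by
  classical
  intro D₁ D₂ h₁ h₂
  have hA : {a | Sum.inr a ∈ vars (base 𝕃 m s)}.Finite :=
    (finite_vars (base 𝕃 m s)).preimage Sum.inr_injective.injOn
  have hW : {x | Sum.inl x ∈ vars (base 𝕃 m s)}.Finite :=
    (finite_vars (base 𝕃 m s)).preimage Sum.inl_injective.injOn
  obtain ⟨g, hg, hgW⟩ := exists_injOn_avoiding hA hW
  let η : V ⊕ F.Term V → F.Term V := Sum.elim .var fun a => .var (g a)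
  let ζ : V → LTerm F V := fun x =>
    if hx : ∃ a, Sum.inr a ∈ vars (base 𝕃 m s) ∧ g a = x then .var (Sum.inr hx.choose)
    else .var (Sum.inl x)
  have hζ : ∀ y ∈ vars (base 𝕃 m s), (η y).subst ζ = .var y := by
    intro y hy
    cases y with
    | inl x =>
      have hx : ¬ ∃ a, Sum.inr a ∈ vars (base 𝕃 m s) ∧ g a = x := by
        rintro ⟨a, ha, rfl⟩
        exact hgW a ha hy
      simp [η, ζ, hx]
    | inr a =>
      have hx : ∃ b, Sum.inr b ∈ vars (base 𝕃 m s) ∧ g b = g a := ⟨a, hy, rfl⟩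
      have : hx.choose = a := hg hx.choose_spec.1 hy hx.choose_spec.2
      simp only [η, ζ, Sum.elim_inr, subst_var_eq, dif_pos hx, this]
  have hback : ∀ D, vars D ⊆ vars (base 𝕃 m s) → (D.subst η).subst ζ = D := by
    intro D hD
    rw [subst_subst, subst_congr fun y hy => hζ y (hD hy), subst_var]
  obtain ⟨e, he₁, he₂⟩ := hconf _ (h.rankLE_base_subst s g) _ _ (h₁.subst η) (h₂.subst η)
  refine ⟨e.subst ζ, ?_, ?_⟩
  · have := he₁.subst ζ
    rwa [hback _ h₁.vars_subset] at this
  · have := he₂.subst ζ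
    rwa [hback _ h₂.vars_subset] at this

end Base

/-! ### Reduction in the base. -/

section BaseSteps

variable {F : FirstOrder.Language.{u, v}} {V : Type w} {𝕃 : Set (Ctx F V)} {R : TRS F V} {m : ℕ}

theorem replaceAt_self {X : Type*} {t a : F.Term X} {q : List ℕ} (h : subtermAt t q = some a) :
    replaceAt t q a = t := by
  induction q generalizing t with
  | nil => simp_all
  | cons j q ih =>
    obtain ⟨n, f, ts, i, rfl, rfl, hi⟩ := exists_func_of_subtermAt_cons h
    rw [replaceAt_func_cons, ih hi, Function.update_eq_self]

theorem Expanded.unfoldLabels_eq {P : F.Term V → Prop} {E Z : LTerm F V} (h : Expanded 𝕃 P E Z)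
    (hP : ∀ b, P b → RankLE 𝕃 m b) : unfoldLabels 𝕃 m Z = unfoldLabels 𝕃 m E := by
  induction h with
  | inl x => rfl
  | keep b => rfl
  | @expand b Z hb hval hZ =>
    rw [unfoldLabels_inr_of_rankLE (hP b hb), unfoldLabels_eq_unlabelled, hval]
    exact fun c hc => hZ m (hP b hb).succ c hc
  | func f _ ih =>
    simp only [unfoldLabels, subst_func_eq] at ih ⊢
    congr 1
    funext i
    exact ih i

/-- A redex of the base lies in the max-top or in an alien of rank at most `m`. In the second case
the alien keeps rank at most `m`, so it stays fully visible even if the max-top absorbs part of it.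
-/
theorem IsLayered.step_base (h : IsLayered 𝕃 R) {ρ : Rule F V} (hρ : ρ ∈ R) {s t : F.Term V}
    {p : List ℕ} (hst : StepAt ρ p s t) (hp : IsFunPos (base 𝕃 m s) p) :
    ∃ D, StepAt ρ p (base 𝕃 m s) D ∧ val D = t ∧ (D = base 𝕃 m t ∨ D = .var (Sum.inr t)) := by
  have hL := h.isLayerSystem
  rcases (hL.maxTop_fits s).isFunPos_or hst.isFunPos with hp' | ⟨q, p, rfl, hq⟩
  · obtain ⟨D, hD, hval, h'⟩ := h.step_maxTop hρ hst hp'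
    refine ⟨unfoldLabels 𝕃 m D, hD.subst _, by rw [val_unfoldLabels, hval], ?_⟩
    rcases h' with rfl | rfl
    · exact Or.inl rfl
    · by_cases ht : RankLE 𝕃 m t
      · left
        rw [unfoldLabels_inr_of_rankLE ht, hL.base_eq_unlabelled ht.succ]
      · exact Or.inr (unfoldLabels_inr_of_not_rankLE ht)
  · obtain ⟨a, b, ha, hab, rfl⟩ := hL.step_alien hst hq
    have hbase : subtermAt (base 𝕃 m s) q = some (unfoldLabels 𝕃 m (.var (Sum.inr a))) :=
      subtermAt_subst ha _
    have hrank : RankLE 𝕃 m a := by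
      -- A hidden alien is a variable of the base, so no function symbol occurs there or below.
      by_contra hna
      rw [unfoldLabels_inr_of_not_rankLE hna] at hbase
      obtain ⟨n, f, ts, hp⟩ := hp
      rw [subtermAt_append, hbase] at hp
      exact not_isFunPos_var _ ⟨n, f, ts, hp⟩
    have hrank' : RankLE 𝕃 m b := h.rankLE_step hrank ⟨ρ, hρ, p, hab⟩
    rw [unfoldLabels_inr_of_rankLE hrank] at hbase
    have hE := hL.expanded_aliens h.condC2 (retagged_replaceAt (P := RankLE 𝕃 m) ha hrank')
    have hD : replaceAt (base 𝕃 m s) q (unlabelled b) =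
        base 𝕃 m (val (replaceAt (aliens 𝕃 s) q (.var (Sum.inr b)))) := by
      rw [base, base, hE.unfoldLabels_eq fun _ => id, unfoldLabels, unfoldLabels,
        replaceAt_subst ha]
      congr 1
      exact (unfoldLabels_inr_of_rankLE hrank').symm
    refine ⟨_, (hab.subst _).append hbase, ?_, Or.inl hD⟩
    exact (congrArg val hD).trans (hL.val_base _)

theorem IsLayered.eq_of_rewrites_base (h : IsLayered 𝕃 R) {s : F.Term V} {D : LTerm F V}
    (hD : Rewrites R (base 𝕃 m s) D) : D = base 𝕃 m (val D) ∨ D = .var (Sum.inr (val D)) := by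
  obtain ⟨ρ, hρ, p, hD⟩ := hD
  have hst : StepAt ρ p s (val D) := by
    have := hD.subst (Sum.elim .var id)
    rwa [show (base 𝕃 m s).subst _ = s from h.isLayerSystem.val_base s] at this
  obtain ⟨D', hD', hval, hor⟩ := h.step_base hρ hst hD.isFunPos
  rwa [hD'.unique hD] at hor

/-- A rewrite step in the base of a term. -/
def BaseStep (𝕃 : Set (Ctx F V)) (R : TRS F V) (m : ℕ) (s t : F.Term V) : Prop :=
  ∃ D, Rewrites R (base 𝕃 m s) D ∧ val D = t

/-- The reflexive and transitive closure of `BaseStep 𝕃 R m`. -/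
abbrev BaseReduces (𝕃 : Set (Ctx F V)) (R : TRS F V) (m : ℕ) : F.Term V → F.Term V → Prop :=
  Relation.ReflTransGen (BaseStep 𝕃 R m)

theorem IsLayerSystem.reduces_of_baseReduces (h : IsLayerSystem 𝕃) {s t : F.Term V}
    (hst : BaseReduces 𝕃 R m s t) : Reduces R s t := by
  induction hst with
  | refl => exact .refl
  | @tail u _ _ hst ih =>
    obtain ⟨D, hD, rfl⟩ := hst
    have := hD.subst (Sum.elim .var id)
    rw [show (base 𝕃 m u).subst _ = u from h.val_base u] at this
    exact ih.tail this

/-- A bare label is a normal form, so a collapse can only be the last step and the base is tracked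
faithfully until then. -/
theorem IsLayered.baseReduces_of_reduces_base (h : IsLayered 𝕃 R) {s : F.Term V} {D : LTerm F V}
    (hD : Reduces R (base 𝕃 m s) D) : BaseReduces 𝕃 R m s (val D) ∧
      (D = base 𝕃 m (val D) ∨ D = .var (Sum.inr (val D))) := by
  induction hD with
  | refl => rw [h.isLayerSystem.val_base]; exact ⟨.refl, Or.inl rfl⟩
  | @tail D' D _ hD ih =>
    obtain ⟨ih, e | e⟩ := ih
    · rw [e] at hD
      exact ⟨ih.tail ⟨D, hD, rfl⟩, h.eq_of_rewrites_base hD⟩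
    · rw [e] at hD
      exact (not_rewrites_var hD).elim

theorem IsLayered.baseReduces_of_rankLE (h : IsLayered 𝕃 R) {s t : F.Term V}
    (hs : RankLE 𝕃 (m + 1) s) (hst : Reduces R s t) : BaseReduces 𝕃 R m s t := by
  have hred : Reduces R (unlabelled s) (unlabelled t) := hst.subst _
  rw [← h.isLayerSystem.base_eq_unlabelled hs] at hred
  have := (h.baseReduces_of_reduces_base hred).1
  rwa [val_unlabelled] at this

theorem IsLayered.exists_reduces_base (h : IsLayered 𝕃 R) {s t : F.Term V}
    (hs : RankLE 𝕃 (m + 2) s) (hst : BaseReduces 𝕃 R m s t) :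
    Reduces R (base 𝕃 m s) (base 𝕃 m t) ∨ ∃ a, RankLE 𝕃 (m + 1) a ∧
      Reduces R (base 𝕃 m s) (.var (Sum.inr a)) ∧ Reduces R a t := by
  induction hst with
  | refl => exact Or.inl .refl
  | @tail u t _ hst ih =>
    rcases ih with ih | ⟨a, ha, h1, h2⟩
    · obtain ⟨D, hD, rfl⟩ := hst
      rcases h.eq_of_rewrites_base hD with e | e
      · exact Or.inl (ih.tail (e ▸ hD))
      · rw [e] at hD
        have hred : Reduces R _ _ := ih.tail hD
        exact Or.inr ⟨_, rankLE_of_mem_vars_base hs (hred.vars_subset rfl), hred, .refl⟩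
    · exact Or.inr ⟨a, ha, h1,
        h2.trans (h.isLayerSystem.reduces_of_baseReduces (Relation.ReflTransGen.single hst))⟩

theorem eq_of_reduces_var {X : Type*} {x : X} {t : F.Term X} (h : Reduces R (.var x) t) :
    t = .var x := by
  induction h with
  | refl => rfl
  | tail _ h ih => rw [ih] at h; exact (not_rewrites_var h).elim

/-- The bases of the reducts are joined by `confluentAt_base`. If one side has collapsed to a label,
the common reduct is that label, so the other side reaches it too; the remaining reductions start
from a term of rank at most `m + 1`, where base reduction is ordinary reduction. -/
theorem IsLayered.baseReduces_confluent [Infinite V] (h : IsLayered 𝕃 R)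
    (hconf : ∀ t : F.Term V, RankLE 𝕃 (m + 1) t → ConfluentAt R t) {s t₁ t₂ : F.Term V}
    (hs : RankLE 𝕃 (m + 2) s) (h₁ : BaseReduces 𝕃 R m s t₁) (h₂ : BaseReduces 𝕃 R m s t₂) :
    ∃ u, BaseReduces 𝕃 R m t₁ u ∧ BaseReduces 𝕃 R m t₂ u := by
  have hb := h.isLayerSystem.confluentAt_base hconf s
  rcases h.exists_reduces_base hs h₁ with d₁ | ⟨a, ha, d₁, e₁⟩ <;>
    rcases h.exists_reduces_base hs h₂ with d₂ | ⟨b, hb', d₂, e₂⟩ <;>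
    obtain ⟨D, hD₁, hD₂⟩ := hb _ _ d₁ d₂
  · exact ⟨val D, (h.baseReduces_of_reduces_base hD₁).1, (h.baseReduces_of_reduces_base hD₂).1⟩
  · obtain rfl := eq_of_reduces_var hD₂
    exact ⟨t₂, (h.baseReduces_of_reduces_base hD₁).1.trans (h.baseReduces_of_rankLE hb' e₂), .refl⟩
  · obtain rfl := eq_of_reduces_var hD₁
    exact ⟨t₁, .refl, (h.baseReduces_of_reduces_base hD₂).1.trans (h.baseReduces_of_rankLE ha e₁)⟩
  · obtain rfl := eq_of_reduces_var hD₁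
    obtain rfl : a = b := by cases eq_of_reduces_var hD₂; rfl
    obtain ⟨u, hu₁, hu₂⟩ := hconf a ha _ _ e₁ e₂
    exact ⟨u, h.baseReduces_of_rankLE (h.rankLE_reduces ha e₁) hu₁,
      h.baseReduces_of_rankLE (h.rankLE_reduces ha e₂) hu₂⟩

end BaseSteps

/-! ### Simultaneous reduction of labels and its interaction with the base. -/

section AlienSteps

variable {F : FirstOrder.Language.{u, v}} {V : Type w} {𝕃 : Set (Ctx F V)} {R : TRS F V} {m : ℕ}

theorem exists_common_reduct {X : Type*} {a : F.Term X} (ha : ConfluentAt R a) {B : Set (F.Term X)}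
    (hB : B.Finite) (h : ∀ b ∈ B, ∃ d, Reduces R a d ∧ Reduces R b d) :
    ∃ u, Reduces R a u ∧ ∀ b ∈ B, Reduces R b u := by
  induction B, hB using Set.Finite.induction_on with
  | empty => exact ⟨a, .refl, by simp⟩
  | @insert b B _ _ ih =>
    obtain ⟨u, hu, hBu⟩ := ih fun b hb => h b (Set.mem_insert_of_mem _ hb)
    obtain ⟨d, had, hbd⟩ := h b (Set.mem_insert _ _)
    obtain ⟨e, hue, hde⟩ := ha _ _ hu had
    refine ⟨e, hu.trans hue, ?_⟩
    rintro c (rfl | hc)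
    · exact hbd.trans hde
    · exact (hBu c hc).trans hue

/-- Confluence makes joinability an equivalence on `A`, and each of its finitely many classes has a
common reduct. -/
theorem exists_balancing {X : Type*} {A : Set (F.Term X)} (hA : A.Finite)
    (hconf : ∀ a ∈ A, ConfluentAt R a) :
    ∃ ψ : F.Term X → F.Term X, (∀ a ∈ A, Reduces R a (ψ a)) ∧
      ∀ a ∈ A, ∀ b ∈ A, (∃ d, Reduces R a d ∧ Reduces R b d) → ψ a = ψ b := by
  let J : F.Term X → F.Term X → Prop := fun a b => ∃ d, Reduces R a d ∧ Reduces R b d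
  have hJ : ∀ a ∈ A, ∀ b c, J a b → J a c → J b c := by
    rintro a ha b c ⟨d, had, hbd⟩ ⟨e, hae, hce⟩
    obtain ⟨f, hdf, hef⟩ := hconf a ha _ _ had hae
    exact ⟨f, hbd.trans hdf, hce.trans hef⟩
  have hsymm : ∀ a b, J a b → J b a := fun a b ⟨d, h₁, h₂⟩ => ⟨d, h₂, h₁⟩
  -- The choice depends only on the predicate, which is the same for joinable elements; hence they
  -- get equal images.
  refine ⟨fun a => @Classical.epsilon _ ⟨a⟩ fun u => ∀ c ∈ A, J a c → Reduces R c u, ?_, ?_⟩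
  · intro a ha
    obtain ⟨u, _, hu⟩ := exists_common_reduct (hconf a ha) (B := {c ∈ A | J a c})
      (hA.subset fun _ h => h.1) fun _ h => h.2
    exact @Classical.epsilon_spec _ (fun u => ∀ c ∈ A, J a c → Reduces R c u)
      ⟨u, fun c hc hac => hu c ⟨hc, hac⟩⟩ a ha ⟨a, .refl, .refl⟩
  · intro a ha b hb hab
    have : ∀ c, J a c ↔ J b c :=
      fun c => ⟨hJ a ha b c hab, hJ b hb a c (hsymm a b hab)⟩
    simp only [this]

/-- Reduction of the labels of the base of a term such that equal labels are reduced to equal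
terms. -/
def AlienReduces (𝕃 : Set (Ctx F V)) (R : TRS F V) (m : ℕ) (s t : F.Term V) : Prop :=
  ∃ ψ : F.Term V → F.Term V, (∀ a, Sum.inr a ∈ vars (base 𝕃 m s) → Reduces R a (ψ a)) ∧
    t = (base 𝕃 m s).subst (Sum.elim .var ψ)

theorem IsLayerSystem.alienReduces_refl (h : IsLayerSystem 𝕃) (s : F.Term V) :
    AlienReduces 𝕃 R m s s :=
  ⟨id, fun _ _ => .refl, (h.val_base s).symm⟩

theorem IsLayerSystem.reduces_of_alienReduces (h : IsLayerSystem 𝕃) {s t : F.Term V}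
    (hst : AlienReduces 𝕃 R m s t) : Reduces R s t := by
  obtain ⟨ψ, hψ, rfl⟩ := hst
  have : Reduces R (val (base 𝕃 m s)) ((base 𝕃 m s).subst (Sum.elim .var ψ)) := by
    refine Reduces.subst_left fun y hy => ?_
    cases y with
    | inl x => exact .refl
    | inr a => exact hψ a hy
  rwa [h.val_base] at this

theorem Expanded.shape_unfoldLabels_below {P : F.Term V → Prop} {E Z : LTerm F V}
    (h : Expanded 𝕃 P E Z) (hP : ∀ b, P b → RankLE 𝕃 (m + 1) b) :
    Below (shape (unfoldLabels 𝕃 m E)) (shape (unfoldLabels 𝕃 m Z)) := by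
  induction h with
  | inl x => exact .refl _
  | keep b => exact .refl _
  | @expand b Z hb hval hZ =>
    rw [unfoldLabels_eq_unlabelled (hZ m (hP b hb)), hval]
    by_cases hbm : RankLE 𝕃 m b
    · rw [unfoldLabels_inr_of_rankLE hbm]
      exact .refl _
    · rw [unfoldLabels_inr_of_not_rankLE hbm]
      exact .hole_below _
  | func f _ ih => exact .mono f ih

/-- The labelled term `E` with `φ` applied to those labels that have rank greater than `m`. -/
noncomputable def mapLabels (𝕃 : Set (Ctx F V)) (m : ℕ) (φ : F.Term V → F.Term V) (E : LTerm F V) :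
    LTerm F V :=
  open Classical in E.subst (Sum.elim (fun x => .var (Sum.inl x))
    fun a => .var (Sum.inr (if RankLE 𝕃 m a then a else φ a)))

theorem val_mapLabels (φ : F.Term V → F.Term V) (s : F.Term V) :
    val (mapLabels 𝕃 m φ (aliens 𝕃 s)) = (base 𝕃 m s).subst (Sum.elim .var φ) := by
  rw [val, mapLabels, base, unfoldLabels, subst_subst, subst_subst]
  refine subst_congr fun y _ => ?_
  cases y with
  | inl x => rfl
  | inr a =>
    by_cases ha : RankLE 𝕃 m a
    · simp only [Sum.elim_inr, ha, if_true]
      rw [unlabelled_subst]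
      exact (subst_var a).symm
    · simp [ha]

theorem shape_unfoldLabels_below_mapLabels (φ : F.Term V → F.Term V) (E : LTerm F V) :
    Below (shape (unfoldLabels 𝕃 m E)) (shape (unfoldLabels 𝕃 m (mapLabels 𝕃 m φ E))) := by
  induction E with
  | var y =>
    cases y with
    | inl x => exact .refl _
    | inr a =>
      by_cases ha : RankLE 𝕃 m a
      · simpa [mapLabels, ha] using Below.refl _
      · rw [unfoldLabels_inr_of_not_rankLE ha]
        exact .hole_below _
  | func f Es ih => exact .mono f ih

theorem IsLayered.retagged_mapLabels (h : IsLayered 𝕃 R) {s : F.Term V}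
    (hs : RankLE 𝕃 (m + 2) s) {φ : F.Term V → F.Term V}
    (hφ : ∀ a, Sum.inr a ∈ vars (base 𝕃 m s) → Reduces R a (φ a)) :
    Retagged (RankLE 𝕃 (m + 1)) (aliens 𝕃 s) (mapLabels 𝕃 m φ (aliens 𝕃 s)) := by
  classical
  refine retagged_subst fun a ha => ?_
  by_cases hr : RankLE 𝕃 m a
  · exact Or.inl (by simp [hr])
  · refine Or.inr ?_
    rw [if_neg hr]
    exact h.rankLE_reduces (hs a ha) (hφ a (mem_vars_subst.2 ⟨_, ha, by simp [hr]⟩))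

theorem isFunPos_shape_iff {E : LTerm F V} {p : List ℕ} : IsFunPos (shape E) p ↔ IsFunPos E p := by
  refine ⟨?_, fun h => h.subst _⟩
  rintro ⟨n, f, Cs, h⟩
  obtain ⟨a, ha, _⟩ := (shape_fits_val E).exists_subtermAt h
  have := subtermAt_labelHoles h ha
  rw [labelHoles_shape_val] at this
  exact ⟨n, f, _, this⟩

theorem Below.isFunPos {C D : Ctx F V} {p : List ℕ} (h : Below C D) (hp : IsFunPos C p) :
    IsFunPos D p := by
  obtain ⟨n, f, Cs, hp⟩ := hp
  obtain ⟨d, hd, hCd⟩ := h.exists_subtermAt hp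
  obtain ⟨Ds, rfl, _⟩ := func_below_iff.1 hCd
  exact ⟨n, f, Ds, hd⟩

/-- Reducing labels can only enlarge the visible part: unchanged holes persist and changed ones are
either kept or filled. -/
theorem IsLayered.isFunPos_base_of_alienReduces (h : IsLayered 𝕃 R) {s t : F.Term V}
    (hs : RankLE 𝕃 (m + 2) s) (hst : AlienReduces 𝕃 R m s t) {p : List ℕ}
    (hp : IsFunPos (base 𝕃 m s) p) : IsFunPos (base 𝕃 m t) p := by
  obtain ⟨ψ, hψ, rfl⟩ := hst
  rw [← val_mapLabels]
  rw [← isFunPos_shape_iff] at hp ⊢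
  have hE := h.isLayerSystem.expanded_aliens h.condC2 (h.retagged_mapLabels hs hψ)
  exact ((shape_unfoldLabels_below_mapLabels ψ _).trans
    (hE.shape_unfoldLabels_below fun _ => id)).isFunPos hp

/-- Equal labels have equal images under `ψ`, so the redex survives, and it is still in the base. If
the step on the side of `s` collapses to a label, then `s'` is that label and reduces to its image
by base steps. -/
theorem IsLayered.alienReduces_baseStep (h : IsLayered 𝕃 R) {s t s' : F.Term V}
    (hs : RankLE 𝕃 (m + 2) s) (hst : AlienReduces 𝕃 R m s t) (hss' : BaseStep 𝕃 R m s s') :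
    ∃ t', BaseReduces 𝕃 R m t t' ∧ (AlienReduces 𝕃 R m s' t' ∨ BaseReduces 𝕃 R m s' t') := by
  have hfun := fun p => h.isFunPos_base_of_alienReduces hs hst (p := p)
  obtain ⟨ψ, hψ, rfl⟩ := hst
  obtain ⟨D, hD, rfl⟩ := hss'
  have hD' := h.eq_of_rewrites_base hD
  obtain ⟨ρ, hρ, p, hD⟩ := hD
  refine ⟨D.subst (Sum.elim .var ψ), ?_, ?_⟩
  · obtain ⟨D₁, hD₁, hval, _⟩ := h.step_base hρ (hD.subst _) (hfun p hD.isFunPos)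
    exact .single ⟨D₁, ⟨ρ, hρ, p, hD₁⟩, hval⟩
  · rcases hD' with e | e
    · left
      refine ⟨ψ, fun a ha => hψ a (hD.vars_subset (e ▸ ha)), ?_⟩
      rw [← e]
    · right
      have ha : Sum.inr (val D) ∈ vars (base 𝕃 m s) := hD.vars_subset (e ▸ rfl)
      have hr := h.baseReduces_of_rankLE (rankLE_of_mem_vars_base hs ha) (hψ _ ha)
      generalize val D = a at *
      subst e
      exact hr

theorem IsLayered.alienReduces_baseReduces [Infinite V] (h : IsLayered 𝕃 R)
    (hconf : ∀ t : F.Term V, RankLE 𝕃 (m + 1) t → ConfluentAt R t) {s t s' : F.Term V}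
    (hs : RankLE 𝕃 (m + 2) s) (hst : AlienReduces 𝕃 R m s t) (hss' : BaseReduces 𝕃 R m s s') :
    ∃ t', BaseReduces 𝕃 R m t t' ∧ (AlienReduces 𝕃 R m s' t' ∨ BaseReduces 𝕃 R m s' t') := by
  induction hss' with
  | refl => exact ⟨t, .refl, Or.inl hst⟩
  | @tail u s' hsu hus ih =>
    have hu : RankLE 𝕃 (m + 2) u :=
      h.rankLE_reduces hs (h.isLayerSystem.reduces_of_baseReduces hsu)
    obtain ⟨t', htt', hut | hut⟩ := ih
    · obtain ⟨t'', h₁, h₂⟩ := h.alienReduces_baseStep hu hut hus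
      exact ⟨t'', htt'.trans h₁, h₂⟩
    · obtain ⟨t'', h₁, h₂⟩ := h.baseReduces_confluent hconf hu hut (.single hus)
      exact ⟨t'', htt'.trans h₁, Or.inr h₂⟩

/-- Labels that have become visible are reduced to their `ψ`-images at once; the others are left for
a subsequent label reduction. The last clause later excludes a collapse of the base. -/
theorem Expanded.exists_reduces {E Z : LTerm F V} (h : Expanded 𝕃 (RankLE 𝕃 (m + 1)) E Z)
    {ψ : F.Term V → F.Term V} (hψ : ∀ a, Sum.inr a ∈ vars E → Reduces R a (ψ a)) :
    ∃ D : LTerm F V, Reduces R (unfoldLabels 𝕃 m Z) D ∧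
      D.subst (Sum.elim .var ψ) = E.subst (Sum.elim .var ψ) ∧
      (∀ a, Sum.inr a ∈ vars D → Sum.inr a ∈ vars E) ∧
      ∀ a, D = .var (Sum.inr a) → E = .var (Sum.inr a) := by
  have hun : ∀ b, Reduces R b (ψ b) → ∃ D : LTerm F V, Reduces R (unlabelled b) D ∧
      D.subst (Sum.elim .var ψ) = ψ b ∧ ∀ a, Sum.inr a ∉ vars D := by
    intro b hb
    refine ⟨unlabelled (ψ b), hb.subst _, ?_, fun a => inr_notMem_vars_unlabelled⟩
    rw [unlabelled_subst]
    exact subst_var _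
  induction h with
  | inl x => exact ⟨_, .refl, rfl, fun _ => id, fun _ => id⟩
  | keep b =>
    by_cases hb : RankLE 𝕃 m b
    · obtain ⟨D, h₁, h₂, h₃⟩ := hun b (hψ b rfl)
      rw [unfoldLabels_inr_of_rankLE hb]
      exact ⟨D, h₁, h₂, fun a ha => (h₃ a ha).elim, fun a e => (h₃ a (e ▸ rfl)).elim⟩
    · rw [unfoldLabels_inr_of_not_rankLE hb]
      exact ⟨_, .refl, rfl, fun _ => id, fun _ => id⟩
  | @expand b Z hb hval hZ =>
    obtain ⟨D, h₁, h₂, h₃⟩ := hun b (hψ b rfl)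
    rw [unfoldLabels_eq_unlabelled (hZ m hb), hval]
    exact ⟨D, h₁, h₂, fun a ha => (h₃ a ha).elim, fun a e => (h₃ a (e ▸ rfl)).elim⟩
  | func f _ ih =>
    choose Ds h₁ h₂ h₃ _ using fun i => ih i fun a ha => hψ a (mem_vars_func.2 ⟨i, ha⟩)
    refine ⟨.func f Ds, Reduces.func f h₁, ?_, fun a ha => ?_, nofun⟩
    · rw [subst_func_eq, subst_func_eq]
      exact congrArg _ (funext h₂)
    · obtain ⟨i, hi⟩ := mem_vars_func.1 ha
      exact mem_vars_func.2 ⟨i, h₃ i a hi⟩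

theorem IsLayered.exists_baseReduces_alienReduces (h : IsLayered 𝕃 R) {s : F.Term V}
    {E : LTerm F V} (hE : Retagged (RankLE 𝕃 (m + 1)) (aliens 𝕃 s) E) {ψ : F.Term V → F.Term V}
    (hψ : ∀ a, Sum.inr a ∈ vars E → Reduces R a (ψ a)) :
    ∃ u, BaseReduces 𝕃 R m (val E) u ∧ AlienReduces 𝕃 R m u (E.subst (Sum.elim .var ψ)) := by
  obtain ⟨D, hD, hsub, hvars, hne⟩ :=
    (h.isLayerSystem.expanded_aliens h.condC2 hE).exists_reduces hψ
  obtain ⟨hred, hD'⟩ := h.baseReduces_of_reduces_base hD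
  have e : D = base 𝕃 m (val D) := by
    refine hD'.resolve_right fun e => ?_
    have hE' := hne _ e
    have := hE.shape_eq
    rw [hE', shape_aliens] at this
    exact h.isLayerSystem.maxTop_ne_hole s this
  exact ⟨val D, hred, ψ, fun a ha => hψ a (hvars a (e ▸ ha)), by rw [← e, hsub]⟩

end AlienSteps

/-! ### Diamond property and induction on the rank. -/

section Confluence

variable {F : FirstOrder.Language.{u, v}} {V : Type w} {𝕃 : Set (Ctx F V)} {R : TRS F V} {m : ℕ}

/-- One `ψ` balances the labels of both results. The images of a label under `φ₁` and `φ₂` are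
joinable, as both are reducts of a confluent term, so `ψ` identifies them. -/
theorem IsLayered.alienReduces_join (h : IsLayered 𝕃 R)
    (hconf : ∀ t : F.Term V, RankLE 𝕃 (m + 1) t → ConfluentAt R t) {s t₁ t₂ : F.Term V}
    (hs : RankLE 𝕃 (m + 2) s) (h₁ : AlienReduces 𝕃 R m s t₁) (h₂ : AlienReduces 𝕃 R m s t₂) :
    ∃ u₁ u₂ v, BaseReduces 𝕃 R m t₁ u₁ ∧ AlienReduces 𝕃 R m u₁ v ∧
      BaseReduces 𝕃 R m t₂ u₂ ∧ AlienReduces 𝕃 R m u₂ v := by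
  classical
  obtain ⟨φ₁, hφ₁, rfl⟩ := h₁
  obtain ⟨φ₂, hφ₂, rfl⟩ := h₂
  rw [← val_mapLabels, ← val_mapLabels]
  have hred : ∀ φ : F.Term V → F.Term V,
      (∀ a, Sum.inr a ∈ vars (base 𝕃 m s) → Reduces R a (φ a)) →
      ∀ a, Sum.inr a ∈ vars (aliens 𝕃 s) → Reduces R a (if RankLE 𝕃 m a then a else φ a) := by
    intro φ hφ a ha
    by_cases hr : RankLE 𝕃 m a
    · rw [if_pos hr]
    · rw [if_neg hr]
      exact hφ a (mem_vars_subst.2 ⟨_, ha, by simp [hr]⟩)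
  have hmem : ∀ (φ : F.Term V → F.Term V) b, Sum.inr b ∈ vars (mapLabels 𝕃 m φ (aliens 𝕃 s)) ↔
      ∃ a, Sum.inr a ∈ vars (aliens 𝕃 s) ∧ b = if RankLE 𝕃 m a then a else φ a := by
    intro φ b
    simp [mapLabels, mem_vars_subst]
  have hrank : ∀ φ : F.Term V → F.Term V,
      (∀ a, Sum.inr a ∈ vars (base 𝕃 m s) → Reduces R a (φ a)) →
      ∀ b, Sum.inr b ∈ vars (mapLabels 𝕃 m φ (aliens 𝕃 s)) → RankLE 𝕃 (m + 1) b := by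
    intro φ hφ b hb
    obtain ⟨a, ha, rfl⟩ := (hmem φ b).1 hb
    exact h.rankLE_reduces (hs a ha) (hred φ hφ a ha)
  have hfin : ∀ φ : F.Term V → F.Term V,
      {b | Sum.inr b ∈ vars (mapLabels 𝕃 m φ (aliens 𝕃 s))}.Finite := fun φ =>
    (finite_vars _).preimage Sum.inr_injective.injOn
  obtain ⟨ψ, hψ, hbal⟩ := exists_balancing ((hfin φ₁).union (hfin φ₂)) (R := R) (by
    rintro b (hb | hb)
    · exact hconf b (hrank φ₁ hφ₁ b hb)
    · exact hconf b (hrank φ₂ hφ₂ b hb))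
  obtain ⟨u₁, hu₁, hv₁⟩ := h.exists_baseReduces_alienReduces (h.retagged_mapLabels hs hφ₁)
    fun b hb => hψ b (Or.inl hb)
  obtain ⟨u₂, hu₂, hv₂⟩ := h.exists_baseReduces_alienReduces (h.retagged_mapLabels hs hφ₂)
    fun b hb => hψ b (Or.inr hb)
  refine ⟨u₁, u₂, _, hu₁, hv₁, hu₂, ?_⟩
  convert hv₂ using 1
  rw [mapLabels, mapLabels, subst_subst, subst_subst]
  refine subst_congr fun y hy => ?_
  cases y with
  | inl x => rfl
  | inr a =>
    simp only [Sum.elim_inr, subst_var_eq]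
    have hb₁ := (hmem φ₁ _).2 ⟨a, hy, rfl⟩
    have hb₂ := (hmem φ₂ _).2 ⟨a, hy, rfl⟩
    obtain ⟨d, hd₁, hd₂⟩ := hconf a (hs a hy) _ _ (hred φ₁ hφ₁ a hy) (hred φ₂ hφ₂ a hy)
    exact hbal _ (Or.inl hb₁) _ (Or.inr hb₂) ⟨d, hd₁, hd₂⟩

/-- A reduction of the base of `s`, followed by a reduction of the labels of the result. -/
def LayerReduces (𝕃 : Set (Ctx F V)) (R : TRS F V) (m : ℕ) (s t : F.Term V) : Prop :=
  RankLE 𝕃 (m + 2) s ∧ ∃ u, BaseReduces 𝕃 R m s u ∧ AlienReduces 𝕃 R m u t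

theorem IsLayerSystem.reduces_of_layerReduces (h : IsLayerSystem 𝕃) {s t : F.Term V}
    (hst : LayerReduces 𝕃 R m s t) : Reduces R s t := by
  obtain ⟨_, u, h₁, h₂⟩ := hst
  exact (h.reduces_of_baseReduces h₁).trans (h.reduces_of_alienReduces h₂)

theorem IsLayered.layerReduces_diamond [Infinite V] (h : IsLayered 𝕃 R)
    (hconf : ∀ t : F.Term V, RankLE 𝕃 (m + 1) t → ConfluentAt R t) {s t₁ t₂ : F.Term V}
    (h₁ : LayerReduces 𝕃 R m s t₁) (h₂ : LayerReduces 𝕃 R m s t₂) :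
    ∃ v, LayerReduces 𝕃 R m t₁ v ∧ LayerReduces 𝕃 R m t₂ v := by
  have hL := h.isLayerSystem
  have ht₁ := h.rankLE_reduces h₁.1 (hL.reduces_of_layerReduces h₁)
  have ht₂ := h.rankLE_reduces h₂.1 (hL.reduces_of_layerReduces h₂)
  obtain ⟨hs, a, hsa, hat⟩ := h₁
  obtain ⟨_, b, hsb, hbt⟩ := h₂
  have ha := h.rankLE_reduces hs (hL.reduces_of_baseReduces hsa)
  have hb := h.rankLE_reduces hs (hL.reduces_of_baseReduces hsb)
  -- The base reductions meet in `c` and are carried across the label reductions, giving `d` and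
  -- `e`. Each of these is reached from `c` by a label or a base reduction, whence four cases.
  obtain ⟨c, hac, hbc⟩ := h.baseReduces_confluent hconf hs hsa hsb
  have hc := h.rankLE_reduces ha (hL.reduces_of_baseReduces hac)
  obtain ⟨d, htd, hcd⟩ := h.alienReduces_baseReduces hconf ha hat hac
  obtain ⟨e, hte, hce⟩ := h.alienReduces_baseReduces hconf hb hbt hbc
  rcases hcd with hcd | hcd <;> rcases hce with hce | hce
  · obtain ⟨u₁, u₂, v, h₁, h₂, h₃, h₄⟩ := h.alienReduces_join hconf hc hcd hce
    exact ⟨v, ⟨ht₁, u₁, htd.trans h₁, h₂⟩, ht₂, u₂, hte.trans h₃, h₄⟩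
  · obtain ⟨v, hdv, hev | hev⟩ := h.alienReduces_baseReduces hconf hc hcd hce
    · exact ⟨v, ⟨ht₁, v, htd.trans hdv, hL.alienReduces_refl v⟩, ht₂, e, hte, hev⟩
    · exact ⟨v, ⟨ht₁, v, htd.trans hdv, hL.alienReduces_refl v⟩, ht₂, v, hte.trans hev,
        hL.alienReduces_refl v⟩
  · obtain ⟨v, hev, hdv | hdv⟩ := h.alienReduces_baseReduces hconf hc hce hcd
    · exact ⟨v, ⟨ht₁, d, htd, hdv⟩, ht₂, v, hte.trans hev, hL.alienReduces_refl v⟩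
    · exact ⟨v, ⟨ht₁, v, htd.trans hdv, hL.alienReduces_refl v⟩, ht₂, v, hte.trans hev,
        hL.alienReduces_refl v⟩
  · obtain ⟨v, hdv, hev⟩ := h.baseReduces_confluent hconf hc hcd hce
    exact ⟨v, ⟨ht₁, v, htd.trans hdv, hL.alienReduces_refl v⟩, ht₂, v, hte.trans hev,
      hL.alienReduces_refl v⟩

/-- A step in the max-top is a base step. For a step from an alien `a` to `b`, balancing the aliens
of `s` together with `b` identifies the images of `a` and `b`, so both terms reach the same result.
-/
theorem IsLayered.exists_layerReduces_of_step (h : IsLayered 𝕃 R)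
    (hconf : ∀ t : F.Term V, RankLE 𝕃 (m + 1) t → ConfluentAt R t) {s t : F.Term V}
    (hs : RankLE 𝕃 (m + 2) s) (hst : Rewrites R s t) :
    ∃ u, LayerReduces 𝕃 R m s u ∧ LayerReduces 𝕃 R m t u := by
  have hL := h.isLayerSystem
  have ht := h.rankLE_step hs hst
  obtain ⟨ρ, hρ, p, hst⟩ := hst
  rcases (hL.maxTop_fits s).isFunPos_or hst.isFunPos with hp | ⟨q, p, rfl, hq⟩
  · obtain ⟨D, hD, hval, _⟩ := h.step_maxTop hρ hst hp
    have hbase : BaseStep 𝕃 R m s t :=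
      ⟨unfoldLabels 𝕃 m D, ⟨ρ, hρ, p, hD.subst _⟩, by rw [val_unfoldLabels, hval]⟩
    exact ⟨t, ⟨hs, t, .single hbase, hL.alienReduces_refl t⟩, ht, t, .refl, hL.alienReduces_refl t⟩
  · obtain ⟨a, b, ha, hab, rfl⟩ := hL.step_alien hst hq
    have hab : Rewrites R a b := ⟨ρ, hρ, p, hab⟩
    have hmem : Sum.inr a ∈ vars (aliens 𝕃 s) := vars_subterm_subset ha rfl
    have hb : RankLE 𝕃 (m + 1) b := h.rankLE_step (hs a hmem) hab
    have hvars := vars_replaceAt_subset ha (.var (Sum.inr b))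
    obtain ⟨ψ, hψ, hbal⟩ := exists_balancing
      (A := {c | Sum.inr c ∈ vars (aliens 𝕃 s) ∪ vars (.var (Sum.inr b) : LTerm F V)}) (R := R)
      (((finite_vars _).union (finite_vars _)).preimage Sum.inr_injective.injOn) (by
        rintro c (hc | hc)
        · exact hconf c (hs c hc)
        · cases hc; exact hconf b hb)
    obtain ⟨u₁, hu₁, hv₁⟩ := h.exists_baseReduces_alienReduces
      (Retagged.refl (RankLE 𝕃 (m + 1)) (aliens 𝕃 s)) fun c hc => hψ c (Or.inl hc)
    obtain ⟨u₂, hu₂, hv₂⟩ := h.exists_baseReduces_alienReduces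
      (retagged_replaceAt (P := RankLE 𝕃 (m + 1)) ha hb) fun c hc => hψ c (hvars hc)
    rw [hL.val_aliens] at hu₁
    refine ⟨_, ⟨hs, u₁, hu₁, hv₁⟩, ht, u₂, hu₂, ?_⟩
    convert hv₂ using 1
    rw [replaceAt_subst ha, replaceAt_self]
    rw [subtermAt_subst ha]
    exact congrArg some (hbal a (Or.inl hmem) b (Or.inr rfl) ⟨b, .single hab, .refl⟩)

/-- A rewrite step need not be a layer reduction, but its ends are joinable by layer reductions. The
diamond property extends this to whole reductions, and layer reductions are ordinary reductions. -/
theorem IsLayered.confluentAt_succ [Infinite V] (h : IsLayered 𝕃 R)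
    (hconf : ∀ t : F.Term V, RankLE 𝕃 (m + 1) t → ConfluentAt R t) {s : F.Term V}
    (hs : RankLE 𝕃 (m + 2) s) : ConfluentAt R s := by
  have hcr : ∀ {a b c}, Relation.ReflTransGen (LayerReduces 𝕃 R m) a b →
      Relation.ReflTransGen (LayerReduces 𝕃 R m) a c →
      Relation.Join (Relation.ReflTransGen (LayerReduces 𝕃 R m)) b c := fun h₁ h₂ =>
    Relation.church_rosser (fun a b c hb hc => by
      obtain ⟨d, h₁, h₂⟩ := h.layerReduces_diamond hconf hb hc
      exact ⟨d, .single h₁, .single h₂⟩) h₁ h₂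
  have hred : ∀ {a b}, Relation.ReflTransGen (LayerReduces 𝕃 R m) a b → Reduces R a b := by
    intro a b hab
    induction hab with
    | refl => exact .refl
    | tail _ hbc ih => exact ih.trans (h.isLayerSystem.reduces_of_layerReduces hbc)
  have hjoin : ∀ t, Reduces R s t →
      Relation.Join (Relation.ReflTransGen (LayerReduces 𝕃 R m)) s t := by
    intro t hst
    induction hst with
    | refl => exact ⟨s, .refl, .refl⟩
    | tail hst htu ih =>
      obtain ⟨u', hu₁, hu₂⟩ := ih
      obtain ⟨v, hv₁, hv₂⟩ := h.exists_layerReduces_of_step hconf (h.rankLE_reduces hs hst) htu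
      obtain ⟨w, hw₁, hw₂⟩ := hcr hu₂ (.single hv₁)
      exact ⟨w, hu₁.trans hw₁, .head hv₂ hw₂⟩
  intro b c hb hc
  obtain ⟨b', hb₁, hb₂⟩ := hjoin b hb
  obtain ⟨c', hc₁, hc₂⟩ := hjoin c hc
  obtain ⟨d, hd₁, hd₂⟩ := hcr hb₁ hc₁
  exact ⟨d, hred (hb₂.trans hd₁), hred (hc₂.trans hd₂)⟩

theorem IsLayered.confluentAt_of_rankLE_one (h : IsLayered 𝕃 R)
    (hrank : IsConfluentOn (Step R) {t : F.Term V | HasRank 𝕃 t 1}) {s : F.Term V}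
    (hs : RankLE 𝕃 1 s) : ConfluentAt R s := by
  have hiff := fun t => hasRank_one_iff h.isLayerSystem (t := t)
  let r : F.Term V → F.Term V → Prop := fun a b => Step R a b ∧
    a ∈ {t : F.Term V | HasRank 𝕃 t 1} ∧ b ∈ {t : F.Term V | HasRank 𝕃 t 1}
  have hto : ∀ t, Reduces R s t → Relation.ReflTransGen r s t := by
    intro t hst
    induction hst with
    | refl => exact .refl
    | tail hst htu ih =>
      have ht := h.rankLE_reduces hs hst
      exact ih.tail ⟨htu, (hiff _).2 ht, (hiff _).2 (h.rankLE_step ht htu)⟩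
  have hfrom : ∀ {a b}, Relation.ReflTransGen r a b → Reduces R a b := by
    intro a b hab
    induction hab with
    | refl => exact .refl
    | tail _ hbc ih => exact ih.tail hbc.1
  intro b c hb hc
  obtain ⟨d, h₁, h₂⟩ := hrank.2 s b c (hto b hb) (hto c hc)
  exact ⟨d, hfrom h₁, hfrom h₂⟩

theorem IsLayered.confluentAt [Infinite V] (h : IsLayered 𝕃 R)
    (hrank : IsConfluentOn (Step R) {t : F.Term V | HasRank 𝕃 t 1}) (s : F.Term V) :
    ConfluentAt R s := by
  suffices H : ∀ k (t : F.Term V), RankLE 𝕃 (k + 1) t → ConfluentAt R t from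
    H _ s (h.isLayerSystem.rankLE_termSize s).succ
  intro k
  induction k with
  | zero => exact fun t ht => h.confluentAt_of_rankLE_one hrank ht
  | succ k ih => exact fun t ht => h.confluentAt_succ ih ht

end Confluence

end LayerSystem

theorem mainTheorem1 (F : FirstOrder.Language.{u, v}) (V : Type w) [Countable V] [Infinite V]
    (𝕃 : Set (LayerSystem.Ctx F V)) (R : LayerSystem.TRS F V)
    (hlayered : LayerSystem.IsLayered 𝕃 R)
    (hrank : LayerSystem.IsConfluentOn (LayerSystem.Step R)
      {t : F.Term V | LayerSystem.HasRank 𝕃 t 1}) :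
    LayerSystem.IsConfluent (LayerSystem.Step R) :=
  fun a b c hb hc => hlayered.confluentAt hrank a b c hb hc
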